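/- For a finite simple graph $G$ with graph distance $d_G$ (with $d_G=\infty$ between different components) and integers $i\ge 0$, $r\ge 1$, put $$\delta^{(i)}(G)=\min_{(x,y):\,xy\in E(G)}\bigl|\{v\in V(G): d_G(x,v)=i,\ d_G(y,v)\ge i\}\bigr|,\qquad \hat d_r(G)=\Bigl(\frac1{r+1}\sum_{i=0}^r\sqrt{\delta^{(i)}(G)\,\delta^{(r-i)}(G)}\Bigr)^{2/r},$$ where the minimum is over both orientations of every edge. There is a function $\eta:\mathbb N\to\mathbb R$ with $\eta(d)\to0$ as $d\to\infty$ such that the following holds. Let $d\ge1$ be an integer and $\varepsilon>0$ a real number with $\varepsilon\log d<1/4$, and let $(r_n)$ be any sequence of non-negative integers with $|r_n-\varepsilon\log n|<1$ for all $n \geq 1$ (for instance $r_n=\lfloor\varepsilon\log n\rfloor$). Let $G_n$ be a uniformly random simple $d$-regular graph on $n$ labelled vertices. Then, with probability tending to $1$ as $n\to\infty$ along the integers $n$ with $nd$ even, all of the following hold: 1. for every vertex $x$, the subgraph of $G_n$ induced on $\{v: d_{G_n}(x,v)\le r_n\}$ contains at most one cycle; 2. $\delta^{(r_n)}(G_n)\ge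 (d-1)^{r_n}-2(d-1)^{r_n-2}$; 3. $|\hat d_{r_n}(G_n)-d|\le\eta(d)\,d$, i.e. $\hat d_{r_n}(G_n)=(1+o_d(1))\,d$. -/

import Mathlib

open Filter Topology

namespace GraphPowering

/-- The closed ball of radius `r` around `x` in the graph distance. -/
def closedBall {V : Type*} (G : SimpleGraph V) (x : V) (r : ℕ) : Set V :=
  {v | G.edist x v ≤ (r : ℕ∞)}

/-- Any two cycles of `H`, regarded as subgraphs of `H`, coincide. -/
def AtMostOneCycle {V : Type*} (H : SimpleGraph V) : Prop :=
  ∀ (u v : V) (p : H.Walk u u) (q : H.Walk v v),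
    p.IsCycle → q.IsCycle → p.toSubgraph = q.toSubgraph

/-- `δ^{(i)}(G)`: the minimum over all edges `(x, y)`, in both orientations, of the number of
vertices `v` with `d_G(x, v) = i` and `d_G(y, v) ≥ i`. The distance is the extended one, so
that vertices in other components are at distance `⊤`. -/
noncomputable def delta {V : Type*} (G : SimpleGraph V) (i : ℕ) : ℕ :=
  sInf {k : ℕ | ∃ x y : V, G.Adj x y ∧
    k = {v : V | G.edist x v = (i : ℕ∞) ∧ (i : ℕ∞) ≤ G.edist y v}.ncard}

/-- `d̂_r(G)`. -/
noncomputable def dHat {V : Type*} (G : SimpleGraph V) (r : ℕ) : ℝ :=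
  ((1 / ((r : ℝ) + 1)) *
    ∑ i ∈ Finset.range (r + 1), Real.sqrt ((delta G i : ℝ) * (delta G (r - i) : ℝ)))
      ^ (2 / (r : ℝ))

open Classical in
/-- The simple `d`-regular graphs on the vertex set `{0, …, n - 1}`. -/
noncomputable def regularGraphs (n d : ℕ) : Finset (SimpleGraph (Fin n)) :=
  Finset.univ.filter fun G => G.IsRegularOfDegree d

open Classical in
/-- The probability of the event `P` for a uniformly random simple `d`-regular graph on `n`
labelled vertices. -/
noncomputable def regularProb (n d : ℕ) (P : SimpleGraph (Fin n) → Prop) : ℝ :=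
  (((regularGraphs n d).filter P).card : ℝ) / ((regularGraphs n d).card : ℝ)

end GraphPowering

/-! Everything follows from one event, `SparseBalls G r`: each ball of radius at most `r` spans no
more edges than vertices. A ball is connected, so on this event it is a tree with at most one extra
edge, which gives the first claim.

For the second claim fix an edge `xy` and let `a i` be the size of the i-th level on the side of
`x`. In a (D+1)-regular graph `a (i+1) ≤ D * a i`. Degree counting in a sparse ball shows that the
losses `D * a i - a (i+1)` add up to at most 2 (`mul_card_levelsBelow_le`). Since `a 1 = D`, the
earliest loss occurs at level 2 and is magnified at most `D ^ (i-2)` times by level `i`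
(`pow_sub_le_of_sum_le`). All products in `dHat` then lie between `(1 - 2/D^2)^2 * D^r` and `D^r`,
so `dHat` is within 3 of `d`, whence η(d) = 3/d.

That the event is likely is a first moment argument. A ball with too many edges contains a
breadth-first tree and two further edges. Tree paths to the ends of these edges form a connected
subgraph with `s ≤ 4r` tree edges, `s + 1` vertices and `s + 2` edges
(`exists_explores_of_not_sparseBalls`). Switching shows that each prescribed edge costs a factor of
about `d/n` (`countContaining_insert_mul_le`). The expected number of such subgraphs is thus about
`n^(s+1) * (d/n)^(s+2)` up to powers of `r`, hence of order at most `d^(4r)/n = n^(4ε log d - 1)` up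
to powers of `log n` and small changes of the exponent. This tends to 0 because `ε log d < 1/4`. -/

namespace GraphPowering

/-! ### Balls, cycles and sparsity -/

section Deterministic

open Classical

variable {V : Type*} {G : SimpleGraph V}

/-- A vertex at distance `k + 1` from `x` has a neighbour at distance `k` from `x`. -/
lemma exists_adj_edist_eq {x v : V} {k : ℕ} (h : G.edist x v = ((k + 1 : ℕ) : ℕ∞)) :
    ∃ u, G.Adj u v ∧ G.edist x u = (k : ℕ∞) := by
  obtain ⟨p, hp⟩ := SimpleGraph.exists_walk_of_edist_eq_coe h
  have hnil : ¬ p.Nil := by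
    intro hn
    have := SimpleGraph.Walk.length_eq_zero_iff.2 hn
    omega
  refine ⟨p.penultimate, p.adj_penultimate hnil, ?_⟩
  have h1 : G.edist x p.penultimate ≤ (k : ℕ∞) := by
    have h2 := SimpleGraph.edist_le p.dropLast
    have h3 : p.dropLast.length = k := by
      simp [SimpleGraph.Walk.dropLast, SimpleGraph.Walk.take_length, hp]
    rwa [h3] at h2
  have h4 : G.edist x v ≤ G.edist x p.penultimate + 1 := by
    refine SimpleGraph.edist_triangle.trans (add_le_add le_rfl ?_)
    exact (SimpleGraph.edist_eq_one_iff_adj.2 (p.adj_penultimate hnil)).le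
  refine le_antisymm h1 ?_
  rw [h] at h4
  push_cast at h4
  exact (ENat.add_le_add_iff_right ENat.one_ne_top).1 h4

lemma edist_le_edist_add_one {x u v : V} (h : G.Adj u v) : G.edist x v ≤ G.edist x u + 1 :=
  SimpleGraph.edist_triangle.trans
    (add_le_add le_rfl (SimpleGraph.edist_eq_one_iff_adj.2 h).le)

/-- The subgraph induced on a closed ball is connected. -/
lemma induce_closedBall_connected (G : SimpleGraph V) (x : V) (r : ℕ) :
    (G.induce (closedBall G x r)).Connected := by
  have hx : x ∈ closedBall G x r := by simp [closedBall]
  have key : ∀ k : ℕ, ∀ v (hv : v ∈ closedBall G x r), G.edist x v = (k : ℕ∞) →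
      (G.induce (closedBall G x r)).Reachable ⟨x, hx⟩ ⟨v, hv⟩ := by
    intro k
    induction k with
    | zero =>
      intro v hv h
      have : x = v := by simpa using h
      subst this
      exact SimpleGraph.Reachable.refl _
    | succ k ih =>
      intro v hv h
      obtain ⟨u, huv, hu⟩ := exists_adj_edist_eq h
      have hv' : G.edist x v ≤ (r : ℕ∞) := hv
      rw [h] at hv'
      have hkr : k + 1 ≤ r := by exact_mod_cast hv'
      have hub : u ∈ closedBall G x r := by
        change G.edist x u ≤ (r : ℕ∞)
        rw [hu]
        exact_mod_cast (by omega : k ≤ r)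
      exact (ih u hub hu).trans (SimpleGraph.Adj.reachable (by simpa using huv))
  have hreach : ∀ v : closedBall G x r,
      (G.induce (closedBall G x r)).Reachable ⟨x, hx⟩ v := by
    rintro ⟨v, hv⟩
    have hv' : G.edist x v ≤ (r : ℕ∞) := hv
    obtain ⟨k, hk⟩ := ENat.ne_top_iff_exists.1 (ne_top_of_le_ne_top (ENat.natCast_ne_top r) hv')
    exact key k v hv hk.symm
  have : Nonempty (closedBall G x r) := ⟨⟨x, hx⟩⟩
  exact ⟨fun u v => (hreach u).symm.trans (hreach v)⟩

/-- A cycle is determined by its edges. -/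
lemma toSubgraph_eq_of_edgeSet_eq {u v : V} {p : G.Walk u u} {q : G.Walk v v}
    (hp : p.IsCycle) (hq : q.IsCycle) (h : ∀ e, e ∈ p.edges ↔ e ∈ q.edges) :
    p.toSubgraph = q.toSubgraph := by
  ext a b
  · rw [SimpleGraph.Walk.mem_verts_toSubgraph, SimpleGraph.Walk.mem_verts_toSubgraph,
      SimpleGraph.Walk.mem_support_iff_exists_mem_edges_of_not_nil hp.not_nil,
      SimpleGraph.Walk.mem_support_iff_exists_mem_edges_of_not_nil hq.not_nil]
    simp only [h]
  · rw [SimpleGraph.Walk.adj_toSubgraph_iff_mem_edges,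
      SimpleGraph.Walk.adj_toSubgraph_iff_mem_edges, h]

/-- Deleting an edge of a cycle keeps a graph connected. -/
lemma connected_deleteEdges_of_mem_cycle (hG : G.Connected) {u : V} {p : G.Walk u u}
    (hp : p.IsCycle) {e : Sym2 V} (he : e ∈ p.edges) : (G.deleteEdges {e}).Connected := by
  induction e with
  | h a b =>
    exact hG.connected_delete_edge_of_not_isBridge
      fun hb => hb.notMem_edges_of_isCycle hp he

/-- A connected graph with no more edges than vertices has at most one cycle. -/
lemma atMostOneCycle_of_card_le [Finite V] (hG : G.Connected)
    (h : Nat.card G.edgeSet ≤ Nat.card V) : AtMostOneCycle G := by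
  have key : ∀ (u v : V) (p : G.Walk u u) (q : G.Walk v v), p.IsCycle → q.IsCycle →
      ∀ e, e ∈ p.edges → e ∈ q.edges := by
    intro u v p q hp hq e hep
    -- If `e` lies on `p` but not on `q`, then `e` and afterwards an edge of `q` can be deleted
    -- without disconnecting the graph, which leaves at most `|V| - 2` edges.
    by_contra heq
    have hc := connected_deleteEdges_of_mem_cycle hG hp hep
    have hne : ∀ f ∈ q.edges, f ∉ ({e} : Set (Sym2 V)) := by
      rintro f hf rfl
      exact heq hf
    have hq' := SimpleGraph.Walk.IsCycle.toDeleteEdges G {e} hq hne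
    obtain ⟨f, hf⟩ : ∃ f, f ∈ (q.toDeleteEdges {e} hne).edges := by
      apply List.exists_mem_of_ne_nil
      intro h0
      have := hq'.not_nil
      exact this (SimpleGraph.Walk.edges_eq_nil.1 h0)
    have hc2 := connected_deleteEdges_of_mem_cycle hc hq' hf
    have hcard := hc2.card_vert_le_card_edgeSet_add_one
    have hfe := SimpleGraph.Walk.edges_subset_edgeSet _ hf
    have heG := SimpleGraph.Walk.edges_subset_edgeSet _ hep
    rw [SimpleGraph.edgeSet_deleteEdges] at hcard hfe
    rw [SimpleGraph.edgeSet_deleteEdges] at hcard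
    rw [Nat.card_coe_set_eq] at hcard
    rw [Nat.card_coe_set_eq] at h
    have h1 := Set.ncard_sdiff_singleton_add_one hfe (Set.toFinite _)
    have h2 := Set.ncard_sdiff_singleton_add_one heG (Set.toFinite _)
    omega
  intro u v p q hp hq
  exact toSubgraph_eq_of_edgeSet_eq hp hq fun e => ⟨key u v p q hp hq e, key v u q p hq hp e⟩

/-- Parent edges are distinct when the parent map decreases a rank. -/
lemma injOn_parent_edge {A : Set V} {f : V → ℕ∞} {par : V → V}
    (h : ∀ v ∈ A, f (par v) < f v) : Set.InjOn (fun v => s(v, par v)) A := by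
  intro u hu v hv huv
  simp only [Sym2.eq_iff] at huv
  rcases huv with h1 | h1
  · exact h1.1
  · have h2 := h u hu
    have h3 := h v hv
    rw [h1.2] at h2
    rw [← h1.1] at h3
    exact absurd h2 h3.not_gt

variable [Fintype V]

/-- The closed ball as a finite set. -/
noncomputable def ballFinset (G : SimpleGraph V) (x : V) (r : ℕ) : Finset V :=
  Finset.univ.filter fun v => G.edist x v ≤ (r : ℕ∞)

/-- The edges of `G` with both ends in `B`. -/
noncomputable def edgesIn (G : SimpleGraph V) (B : Finset V) : Finset (Sym2 V) :=
  Finset.univ.filter fun e => e ∈ G.edgeSet ∧ ∀ v ∈ e, v ∈ B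

/-- Every ball of radius at most `r` spans no more edges than it has vertices. -/
def SparseBalls (G : SimpleGraph V) (r : ℕ) : Prop :=
  ∀ x : V, ∀ i ≤ r, (edgesIn G (ballFinset G x i)).card ≤ (ballFinset G x i).card

lemma mem_edgesIn {B : Finset V} {a b : V} :
    s(a, b) ∈ edgesIn G B ↔ G.Adj a b ∧ a ∈ B ∧ b ∈ B := by
  simp [edgesIn]

lemma SparseBalls.atMostOneCycle {r : ℕ} (h : SparseBalls G r) (x : V) :
    AtMostOneCycle (G.induce (closedBall G x r)) := by
  apply atMostOneCycle_of_card_le (induce_closedBall_connected G x r)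
  have h1 := h x r le_rfl
  have h2 : Nat.card (closedBall G x r) = (ballFinset G x r).card := by
    rw [Nat.card_coe_set_eq, ← Set.ncard_coe_finset]
    congr 1
    ext v
    simp [ballFinset, closedBall]
  have h3 : Nat.card (G.induce (closedBall G x r)).edgeSet
      ≤ (edgesIn G (ballFinset G x r)).card := by
    rw [Nat.card_coe_set_eq, ← Set.ncard_coe_finset]
    apply Set.ncard_le_ncard_of_injOn (Sym2.map Subtype.val)
    · rintro e he
      induction e with
      | h a b =>
        simp only [Sym2.map_mk, Finset.mem_coe]
        rw [mem_edgesIn]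
        exact ⟨by simpa using he, Finset.mem_filter.2 ⟨Finset.mem_univ _, a.2⟩,
          Finset.mem_filter.2 ⟨Finset.mem_univ _, b.2⟩⟩
    · exact (Sym2.map.injective Subtype.val_injective).injOn
  omega

end Deterministic

/-! ### Levels seen from an oriented edge, and their total loss -/

section Levels

open Classical

variable {V : Type*} [Fintype V] {G : SimpleGraph V}

/-- Every vertex of `G` has exactly `d` neighbours. -/
def IsReg (G : SimpleGraph V) (d : ℕ) : Prop :=
  ∀ v, (Finset.univ.filter (G.Adj v)).card = d

/-- The vertices counted by `delta` for the oriented edge `(x, y)`. -/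
noncomputable def level (G : SimpleGraph V) (x y : V) (i : ℕ) : Finset V :=
  Finset.univ.filter fun v => G.edist x v = (i : ℕ∞) ∧ (i : ℕ∞) ≤ G.edist y v

/-- The union of the first `r` levels. -/
noncomputable def levelsBelow (G : SimpleGraph V) (x y : V) (r : ℕ) : Finset V :=
  Finset.univ.filter fun v => G.edist x v < (r : ℕ∞) ∧ G.edist x v ≤ G.edist y v

lemma mem_level {x y v : V} {i : ℕ} :
    v ∈ level G x y i ↔ G.edist x v = (i : ℕ∞) ∧ (i : ℕ∞) ≤ G.edist y v := by
  simp [level]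

lemma mem_levelsBelow {x y v : V} {r : ℕ} :
    v ∈ levelsBelow G x y r ↔ G.edist x v < (r : ℕ∞) ∧ G.edist x v ≤ G.edist y v := by
  simp [levelsBelow]

lemma mem_ballFinset {x v : V} {r : ℕ} : v ∈ ballFinset G x r ↔ G.edist x v ≤ (r : ℕ∞) := by
  simp [ballFinset]

/-- Every vertex of level `i + 1` has a neighbour in level `i`. -/
lemma exists_adj_level {x y v : V} {i : ℕ} (h : v ∈ level G x y (i + 1)) :
    ∃ u ∈ level G x y i, G.Adj u v := by
  rw [mem_level] at h
  obtain ⟨u, huv, hu⟩ := exists_adj_edist_eq h.1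
  refine ⟨u, mem_level.2 ⟨hu, ?_⟩, huv⟩
  have h1 := h.2.trans (edist_le_edist_add_one (x := y) huv)
  push_cast at h1
  exact (ENat.add_le_add_iff_right ENat.one_ne_top).1 h1

lemma level_zero {x y : V} : level G x y 0 = {x} := by
  ext v
  simp only [mem_level, Nat.cast_zero, SimpleGraph.edist_eq_zero_iff, zero_le, and_true,
    Finset.mem_singleton]
  exact eq_comm

lemma level_one {x y : V} :
    level G x y 1 = (Finset.univ.filter (G.Adj x)).erase y := by
  ext v
  rw [mem_level, Finset.mem_erase, Finset.mem_filter]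
  simp only [Nat.cast_one, SimpleGraph.edist_eq_one_iff_adj, Finset.mem_univ, true_and]
  rw [and_comm]
  refine and_congr_left fun _ => ?_
  rw [Order.one_le_iff_ne_zero, Ne, SimpleGraph.edist_eq_zero_iff, eq_comm]

lemma card_level_one {d : ℕ} (hG : IsReg G d) {x y : V} (hxy : G.Adj x y) :
    (level G x y 1).card = d - 1 := by
  rw [level_one, Finset.card_erase_of_mem (by simpa using hxy), hG x]

/-- Each vertex of level `i` has a neighbour outside level `i + 1`: the vertex `y` if `i = 0`, a
parent in level `i - 1` otherwise. -/
lemma card_level_succ_le {d : ℕ} (hG : IsReg G d) {x y : V} (hxy : G.Adj x y) (i : ℕ) :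
    (level G x y (i + 1)).card ≤ (d - 1) * (level G x y i).card := by
  have hsub : level G x y (i + 1) ⊆ (level G x y i).biUnion
      fun u => (level G x y (i + 1)).filter (G.Adj u) := by
    intro v hv
    obtain ⟨u, hu, huv⟩ := exists_adj_level hv
    exact Finset.mem_biUnion.2 ⟨u, hu, Finset.mem_filter.2 ⟨hv, huv⟩⟩
  refine (Finset.card_le_card hsub).trans ?_
  rw [mul_comm]
  apply Finset.card_biUnion_le_card_mul
  intro u hu
  obtain ⟨w, huw, hw⟩ : ∃ w, G.Adj u w ∧ w ∉ level G x y (i + 1) := by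
    cases i with
    | zero =>
      rw [level_zero, Finset.mem_singleton] at hu
      subst hu
      exact ⟨y, hxy, by simp [mem_level]⟩
    | succ i =>
      obtain ⟨w, hw, hwu⟩ := exists_adj_level hu
      refine ⟨w, hwu.symm, fun h => ?_⟩
      rw [mem_level] at h hw
      have h1 := h.1.symm.trans hw.1
      have h2 : i + 1 + 1 = i := by exact_mod_cast h1
      omega
  calc ((level G x y (i + 1)).filter (G.Adj u)).card
      ≤ ((Finset.univ.filter (G.Adj u)).erase w).card := by
        apply Finset.card_le_card
        intro v hv
        rw [Finset.mem_filter] at hv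
        rw [Finset.mem_erase, Finset.mem_filter]
        exact ⟨fun h => hw (h ▸ hv.1), Finset.mem_univ _, hv.2⟩
    _ = d - 1 := by rw [Finset.card_erase_of_mem (by simpa using huw), hG u]

lemma card_level_le {d : ℕ} (hG : IsReg G d) {x y : V} (hxy : G.Adj x y) (i : ℕ) :
    (level G x y i).card ≤ (d - 1) ^ i := by
  induction i with
  | zero => simp [level_zero]
  | succ i ih =>
    calc _ ≤ (d - 1) * (level G x y i).card := card_level_succ_le hG hxy i
      _ ≤ (d - 1) * (d - 1) ^ i := by gcongr
      _ = _ := by ring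

lemma levelsBelow_zero {x y : V} : levelsBelow G x y 0 = ∅ := by
  ext v
  simp [mem_levelsBelow]

lemma levelsBelow_succ {x y : V} (r : ℕ) :
    levelsBelow G x y (r + 1) = levelsBelow G x y r ∪ level G x y r := by
  ext v
  rw [Finset.mem_union, mem_levelsBelow, mem_levelsBelow, mem_level]
  have : G.edist x v < ((r + 1 : ℕ) : ℕ∞) ↔ G.edist x v < (r : ℕ∞) ∨ G.edist x v = (r : ℕ∞) := by
    rw [← le_iff_lt_or_eq]
    push_cast
    exact ENat.lt_add_one_iff (ENat.natCast_ne_top r)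
  rw [this]
  constructor
  · rintro ⟨h | h, h'⟩
    · exact Or.inl ⟨h, h'⟩
    · exact Or.inr ⟨h, h ▸ h'⟩
  · rintro (⟨h, h'⟩ | ⟨h, h'⟩)
    · exact ⟨Or.inl h, h'⟩
    · exact ⟨Or.inr h, h.symm ▸ h'⟩

lemma disjoint_levelsBelow_level {x y : V} (r : ℕ) :
    Disjoint (levelsBelow G x y r) (level G x y r) := by
  rw [Finset.disjoint_left]
  intro v h1 h2
  rw [mem_levelsBelow] at h1
  rw [mem_level] at h2
  exact absurd h2.1 h1.1.ne

lemma card_levelsBelow {x y : V} (r : ℕ) :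
    (levelsBelow G x y r).card = ∑ i ∈ Finset.range r, (level G x y i).card := by
  induction r with
  | zero => simp [levelsBelow_zero]
  | succ r ih =>
    rw [levelsBelow_succ, Finset.card_union_of_disjoint (disjoint_levelsBelow_level r), ih,
      Finset.sum_range_succ]

/-- The degree sum over `A` counts the edges meeting `A` and, once more, those inside `A`. -/
lemma mul_card_le_of_isReg {d : ℕ} (hG : IsReg G d) (A : Finset V) :
    d * A.card ≤ (Finset.univ.filter fun e => e ∈ G.edgeSet ∧ ∃ v ∈ e, v ∈ A).card
      + (edgesIn G A).card := by
  set M := Finset.univ.filter fun e => e ∈ G.edgeSet ∧ ∃ v ∈ e, v ∈ A with hM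
  have hdeg : ∀ v ∈ A, (M.filter fun e => v ∈ e).card = d := by
    intro v hv
    rw [← hG v]
    symm
    apply Finset.card_bij (fun w _ => s(v, w))
    · intro w hw
      simp only [Finset.mem_filter, Finset.mem_univ, true_and] at hw
      simp only [hM, Finset.mem_filter, Finset.mem_univ, true_and, SimpleGraph.mem_edgeSet]
      exact ⟨⟨hw, v, Sym2.mem_mk_left _ _, hv⟩, Sym2.mem_mk_left _ _⟩
    · intro w _ w' _ h
      exact Sym2.congr_right.1 h
    · intro e he
      simp only [hM, Finset.mem_filter, Finset.mem_univ, true_and] at he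
      obtain ⟨w, rfl⟩ := Sym2.mem_iff_exists.1 he.2
      exact ⟨w, by simpa using he.1.1, rfl⟩
  have hsum : d * A.card = ∑ e ∈ M, (A.filter fun v => v ∈ e).card := by
    have h1 := Finset.sum_card_bipartiteAbove_eq_sum_card_bipartiteBelow (s := A) (t := M)
      (fun v e => v ∈ e)
    simp only [Finset.bipartiteAbove, Finset.bipartiteBelow] at h1
    rw [← h1, Finset.sum_congr rfl hdeg, Finset.sum_const, smul_eq_mul, mul_comm]
  have hin : edgesIn G A = M.filter fun e => ∀ v ∈ e, v ∈ A := by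
    ext e
    simp only [edgesIn, hM, Finset.mem_filter, Finset.mem_univ, true_and]
    constructor
    · rintro ⟨h1, h2⟩
      induction e with
      | h a b => exact ⟨⟨h1, a, Sym2.mem_mk_left _ _, h2 a (Sym2.mem_mk_left _ _)⟩, h2⟩
    · rintro ⟨⟨h1, _⟩, h2⟩
      exact ⟨h1, h2⟩
  rw [hsum, hin, Finset.card_eq_sum_ones M,
    Finset.card_filter (fun e => ∀ v ∈ e, v ∈ A) M, ← Finset.sum_add_distrib]
  apply Finset.sum_le_sum
  intro e _
  induction e with
  | h a b =>
    have hsub : (A.filter fun v => v ∈ s(a, b)) ⊆ {a, b} := by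
      intro v hv
      simpa using (Finset.mem_filter.1 hv).2
    split_ifs with h
    · exact (Finset.card_le_card hsub).trans Finset.card_le_two
    · rw [add_zero]
      simp only [Sym2.mem_iff, forall_eq_or_imp, forall_eq, not_and_or] at h
      rcases h with h | h
      · rw [Finset.card_le_one_iff]
        intro u v hu hv
        simp only [Finset.mem_filter, Sym2.mem_iff] at hu hv
        grind
      · rw [Finset.card_le_one_iff]
        intro u v hu hv
        simp only [Finset.mem_filter, Sym2.mem_iff] at hu hv
        grind

/-- In a sparse ball the levels lose at most two vertices in total. -/
lemma mul_card_levelsBelow_le {d : ℕ} (hG : IsReg G d) {x y : V} (hxy : G.Adj x y) {r : ℕ}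
    (hr : 1 ≤ r) (h : (edgesIn G (ballFinset G x r)).card ≤ (ballFinset G x r).card) :
    (d - 1) * (levelsBelow G x y r).card ≤ (levelsBelow G x y (r + 1)).card + 1 := by
  -- `Y` is the part of the ball strictly closer to `y` than to `x`. Four estimates are combined:
  -- `|Y| ≤ e(Y) + 1`, `|M| + e(Y) ≤ e(B) ≤ |Y| + |S|`, `e(A) + |level r| + 1 ≤ |M|` and `d|A| ≤ |M|
  -- + e(A)`.
  set A := levelsBelow G x y r with hA
  set S := levelsBelow G x y (r + 1) with hS
  set B := ballFinset G x r with hB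
  set Y := B \ S with hY
  set M := Finset.univ.filter fun e => e ∈ G.edgeSet ∧ ∃ v ∈ e, v ∈ A with hM
  have hSB : S ⊆ B := by
    intro v hv
    rw [hS, mem_levelsBelow] at hv
    rw [hB, mem_ballFinset]
    have := hv.1
    push_cast at this
    exact (ENat.lt_add_one_iff (ENat.natCast_ne_top r)).1 this
  have hAS : A ⊆ S := by
    rw [hS, levelsBelow_succ]
    exact Finset.subset_union_left
  have hScard : S.card = A.card + (level G x y r).card := by
    rw [hS, levelsBelow_succ, Finset.card_union_of_disjoint (disjoint_levelsBelow_level r)]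
  have hadj : ∀ {a b : V}, a ∈ A → G.Adj a b → b ∈ B := by
    intro a b ha hab
    rw [hA, mem_levelsBelow] at ha
    rw [hB, mem_ballFinset]
    exact (edist_le_edist_add_one hab).trans (Order.add_one_le_of_lt ha.1)
  have hMB : M ⊆ edgesIn G B := by
    intro e he
    simp only [hM, Finset.mem_filter, Finset.mem_univ, true_and] at he
    obtain ⟨he, v, hve, hv⟩ := he
    obtain ⟨w, rfl⟩ := Sym2.mem_iff_exists.1 hve
    exact mem_edgesIn.2 ⟨he, hSB (hAS hv), hadj hv he⟩
  have hyY : y ∈ Y := by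
    rw [hY, Finset.mem_sdiff, hB, mem_ballFinset, hS, mem_levelsBelow,
      SimpleGraph.edist_eq_one_iff_adj.2 hxy]
    refine ⟨by exact_mod_cast hr, fun h => ?_⟩
    have := h.2
    simp at this
  have hxA : x ∈ A := by
    rw [hA, mem_levelsBelow]
    simp only [SimpleGraph.edist_self, zero_le, and_true]
    exact_mod_cast hr
  have hYcard : Y.card ≤ (edgesIn G Y).card + 1 := by
    -- A neighbour `u` of `v` on a shortest path to `y` stays in `Y`: if `u` is at distance `k` from
    -- `y`, both triangle inequalities force distance `k + 1` from `x`. So `Y` contains a tree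
    -- rooted at `y`.
    have hpar : ∀ v ∈ Y.erase y, ∃ u ∈ Y, G.Adj v u ∧ G.edist y u < G.edist y v := by
      intro v hv
      rw [Finset.mem_erase, hY, Finset.mem_sdiff, hB, mem_ballFinset, hS, mem_levelsBelow] at hv
      obtain ⟨hvy, hvB, hvS⟩ := hv
      have hvr : G.edist x v < ((r + 1 : ℕ) : ℕ∞) := by
        push_cast
        exact (ENat.lt_add_one_iff (ENat.natCast_ne_top r)).2 hvB
      have hlt : G.edist y v < G.edist x v := by
        by_contra hcon
        exact hvS ⟨hvr, not_lt.1 hcon⟩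
      obtain ⟨k, hk⟩ := ENat.ne_top_iff_exists.1 hlt.ne_top
      obtain ⟨m, hm⟩ := ENat.ne_top_iff_exists.1
        (ne_top_of_le_ne_top (ENat.natCast_ne_top r) hvB)
      cases k with
      | zero =>
        have : y = v := by
          rw [← SimpleGraph.edist_eq_zero_iff (G := G), ← hk]
          rfl
        exact absurd this.symm hvy
      | succ k =>
        obtain ⟨u, huv, hu⟩ := exists_adj_edist_eq hk.symm
        have hkm : k + 1 < m := by
          rw [← hk, ← hm] at hlt
          exact_mod_cast hlt
        have hmr : m ≤ r := by
          rw [← hm] at hvB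
          exact_mod_cast hvB
        have hxu1 : G.edist x u ≤ ((k + 1 : ℕ) : ℕ∞) := by
          have h1 := SimpleGraph.edist_triangle (G := G) (u := x) (v := y) (w := u)
          rw [SimpleGraph.edist_eq_one_iff_adj.2 hxy, hu] at h1
          push_cast
          rwa [add_comm]
        have hxu2 : ((k + 1 : ℕ) : ℕ∞) ≤ G.edist x u := by
          have h1 := edist_le_edist_add_one (x := x) huv
          rw [← hm] at h1
          have h2 : ((k + 1 + 1 : ℕ) : ℕ∞) ≤ (m : ℕ∞) := by exact_mod_cast hkm
          have h3 := h2.trans h1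
          push_cast at h3 ⊢
          exact (ENat.add_le_add_iff_right ENat.one_ne_top).1 h3
        refine ⟨u, ?_, huv.symm, ?_⟩
        · rw [hY, Finset.mem_sdiff, hB, mem_ballFinset, hS, mem_levelsBelow]
          refine ⟨hxu1.trans (by exact_mod_cast (by omega : k + 1 ≤ r)), fun hcon => ?_⟩
          have h4 := hxu2.trans hcon.2
          rw [hu] at h4
          have : k + 1 ≤ k := by exact_mod_cast h4
          omega
        · rw [hu, ← hk]
          exact_mod_cast Nat.lt_succ_self k
    choose! par hpar1 hpar2 hpar3 using hpar
    have hinj : Set.InjOn (fun v => s(v, par v)) (Y.erase y : Finset V) :=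
      injOn_parent_edge (f := fun v => G.edist y v) fun v hv => hpar3 v hv
    have h1 := Finset.card_le_card_of_injOn (t := edgesIn G Y) (fun v => s(v, par v))
      (fun v hv => mem_edgesIn.2 ⟨hpar2 v hv, Finset.mem_of_mem_erase hv, hpar1 v hv⟩) hinj
    rw [Finset.card_erase_of_mem hyY] at h1
    omega
  have hMY : M.card + (edgesIn G Y).card ≤ (edgesIn G B).card := by
    rw [← Finset.card_union_of_disjoint]
    · apply Finset.card_le_card
      refine Finset.union_subset hMB ?_
      intro e he
      simp only [edgesIn, Finset.mem_filter, Finset.mem_univ, true_and] at he ⊢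
      exact ⟨he.1, fun v hv => (Finset.mem_sdiff.1 (he.2 v hv)).1⟩
    · rw [Finset.disjoint_left]
      intro e h1 h2
      simp only [hM, edgesIn, Finset.mem_filter, Finset.mem_univ, true_and] at h1 h2
      obtain ⟨_, v, hve, hv⟩ := h1
      exact (Finset.mem_sdiff.1 (h2.2 v hve)).2 (hAS hv)
  have hYB : Y.card + S.card = B.card := Finset.card_sdiff_add_card_eq_card hSB
  -- Besides the edges inside `A`, the set `M` contains one parent edge for each vertex of level
  -- `r`, and the edge `xy`.
  have hMA : (edgesIn G A).card + (level G x y r).card + 1 ≤ M.card := by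
    obtain ⟨k, rfl⟩ : ∃ k, r = k + 1 := ⟨r - 1, by omega⟩
    have hpar : ∀ v ∈ level G x y (k + 1), ∃ u ∈ level G x y k, G.Adj u v :=
      fun v hv => exists_adj_level hv
    choose! par hpar1 hpar2 using hpar
    have hparA : ∀ v ∈ level G x y (k + 1), par v ∈ A := by
      intro v hv
      rw [hA, levelsBelow_succ]
      exact Finset.mem_union_right _ (hpar1 v hv)
    have hdis := Finset.disjoint_left.1 (disjoint_levelsBelow_level (G := G) (x := x) (y := y)
      (k + 1))
    set T := (level G x y (k + 1)).image (fun v => s(v, par v)) with hT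
    have hTcard : T.card = (level G x y (k + 1)).card := by
      apply Finset.card_image_of_injOn
      apply injOn_parent_edge (f := fun v => G.edist x v)
      intro v hv
      have h1 := (mem_level.1 (hpar1 v hv)).1
      have h2 := (mem_level.1 (Finset.mem_coe.1 hv)).1
      rw [h1, h2]
      exact_mod_cast Nat.lt_succ_self k
    have hET : Disjoint (edgesIn G A) T := by
      rw [Finset.disjoint_left]
      intro e h1 h2
      obtain ⟨v, hv, rfl⟩ := Finset.mem_image.1 h2
      exact hdis (mem_edgesIn.1 h1).2.1 hv
    have hyS : y ∉ S := (Finset.mem_sdiff.1 hyY).2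
    have hxyn : s(x, y) ∉ edgesIn G A ∪ T := by
      rw [Finset.mem_union]
      rintro (h1 | h1)
      · exact hyS (hAS (mem_edgesIn.1 h1).2.2)
      · obtain ⟨v, hv, hve⟩ := Finset.mem_image.1 h1
        have hvS : v ∈ S := by
          rw [hS, levelsBelow_succ]
          exact Finset.mem_union_right _ hv
        rcases Sym2.eq_iff.1 hve with ⟨_, h2⟩ | ⟨h2, _⟩
        · exact hyS (h2 ▸ hAS (hparA v hv))
        · exact hyS (h2 ▸ hvS)
    rw [← hTcard, ← Finset.card_union_of_disjoint hET, ← Finset.card_insert_of_notMem hxyn]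
    apply Finset.card_le_card
    intro e he
    simp only [hM, Finset.mem_filter, Finset.mem_univ, true_and]
    rcases Finset.mem_insert.1 he with rfl | he
    · exact ⟨hxy, x, Sym2.mem_mk_left _ _, hxA⟩
    rcases Finset.mem_union.1 he with he | he
    · induction e with
      | h a b =>
        rw [mem_edgesIn] at he
        exact ⟨he.1, a, Sym2.mem_mk_left _ _, he.2.1⟩
    · obtain ⟨v, hv, rfl⟩ := Finset.mem_image.1 he
      exact ⟨(hpar2 v hv).symm, par v, Sym2.mem_mk_right _ _, hparA v hv⟩
  have hdeg := mul_card_le_of_isReg hG A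
  rw [← hM] at hdeg
  rw [Nat.sub_mul]
  omega

end Levels

/-! ### Lower bounds for levels and the estimates of `delta` and `dHat` -/

section Delta

open Classical

/-- A sequence that loses at most two units in total with respect to `a (i + 1) = D * a i`. -/
lemma pow_sub_le_of_sum_le {D : ℝ} (hD : 1 ≤ D) {a : ℕ → ℝ} {r : ℕ} (h0 : a 0 = 1)
    (h1 : a 1 = D) (hsum : ∀ j, 1 ≤ j → j ≤ r →
      D * ∑ i ∈ Finset.range j, a i ≤ ∑ i ∈ Finset.range (j + 1), a i + 1)
    (hle : ∀ i, a (i + 1) ≤ D * a i) (k : ℕ) (hk : k + 2 ≤ r) :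
    D ^ (k + 2) - 2 * D ^ k ≤ a (k + 2) := by
  -- As `a 0 = 1`, the bracket is the accumulated loss, the sum of `D * a i - a (i+1)` over `i < k +
  -- 2`. Its term `i = 0` vanishes, so every loss is magnified at most `D ^ k` times.
  have key : ∀ k, D ^ (k + 2) - D ^ k * (D * ∑ i ∈ Finset.range (k + 2), a i
      - ∑ i ∈ Finset.range (k + 3), a i + 1) ≤ a (k + 2) := by
    intro k
    induction k with
    | zero =>
      simp only [Finset.sum_range_succ, Finset.sum_range_zero, h0, h1]
      apply le_of_eq
      ring
    | succ k ih =>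
      rw [Finset.sum_range_succ (fun i => a i) (k + 3),
        Finset.sum_range_succ (fun i => a i) (k + 2)]
      have e : k + 1 + 2 = k + 3 := rfl
      rw [Finset.sum_range_succ (fun i => a i) (k + 2)] at ih
      have h2 : (1 : ℝ) ≤ D ^ (k + 1) := one_le_pow₀ hD
      have h3 := hle (k + 2)
      -- The newest loss has weight 1, which may be raised to `D ^ (k + 1)`.
      have h4 : 0 ≤ (D ^ (k + 1) - 1) * (D * a (k + 2) - a (k + 3)) :=
        mul_nonneg (by linarith) (by
          have : a (k + 2 + 1) = a (k + 3) := rfl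
          linarith)
      have h5 := mul_le_mul_of_nonneg_left ih (by linarith : (0 : ℝ) ≤ D)
      rw [e]
      ring_nf at h4 h5 ⊢
      linarith
  have h2 := key k
  have h3 := hsum (k + 2) (by omega) hk
  have h4 : (0 : ℝ) ≤ D ^ k := by positivity
  have h5 : D ^ k * (D * ∑ i ∈ Finset.range (k + 2), a i
      - ∑ i ∈ Finset.range (k + 3), a i + 1) ≤ D ^ k * 2 := by
    apply mul_le_mul_of_nonneg_left _ h4
    linarith
  linarith

variable {V : Type*} [Fintype V] {G : SimpleGraph V} {d r : ℕ}

/-- The degree is written `d + 1`, so that `d` is the branching number. -/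
lemma card_level_ge (hG : IsReg G (d + 1)) (hd : 1 ≤ d) (h : SparseBalls G r) {x y : V}
    (hxy : G.Adj x y) (k : ℕ) (hk : k + 2 ≤ r) :
    (d : ℝ) ^ (k + 2) - 2 * (d : ℝ) ^ k ≤ (level G x y (k + 2)).card := by
  apply pow_sub_le_of_sum_le (a := fun i => ((level G x y i).card : ℝ)) (r := r)
    (by exact_mod_cast hd)
  · simp [level_zero]
  · simp [card_level_one hG hxy]
  · intro j hj hjr
    have h1 := mul_card_levelsBelow_le hG hxy hj (h x j hjr)
    rw [card_levelsBelow, card_levelsBelow] at h1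
    simp only [Nat.add_sub_cancel] at h1
    exact_mod_cast h1
  · intro i
    have h1 := card_level_succ_le hG hxy i
    simp only [Nat.add_sub_cancel] at h1
    exact_mod_cast h1
  · exact hk

/-- Positive degree provides an edge, so the infimum is attained and is not the default value of
`sInf ∅`. -/
lemma exists_delta_eq [Nonempty V] (hG : IsReg G (d + 1)) (i : ℕ) :
    ∃ x y, G.Adj x y ∧ delta G i = (level G x y i).card := by
  have hne : {k : ℕ | ∃ x y : V, G.Adj x y ∧
      k = {v : V | G.edist x v = (i : ℕ∞) ∧ (i : ℕ∞) ≤ G.edist y v}.ncard}.Nonempty := by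
    obtain ⟨x⟩ := ‹Nonempty V›
    have hx := hG x
    obtain ⟨y, hy⟩ := Finset.card_pos.1 (by omega : 0 < (Finset.univ.filter (G.Adj x)).card)
    exact ⟨_, x, y, by simpa using hy, rfl⟩
  obtain ⟨x, y, hxy, h⟩ := Nat.sInf_mem hne
  refine ⟨x, y, hxy, ?_⟩
  rw [delta, h, ← Set.ncard_coe_finset]
  congr 1
  ext v
  simp [mem_level]

lemma delta_le [Nonempty V] (hG : IsReg G (d + 1)) (i : ℕ) : (delta G i : ℝ) ≤ (d : ℝ) ^ i := by
  obtain ⟨x, y, hxy, h⟩ := exists_delta_eq hG i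
  rw [h]
  exact_mod_cast card_level_le hG hxy i

lemma le_delta [Nonempty V] (hG : IsReg G (d + 1)) (hd : 1 ≤ d) (h : SparseBalls G r) (k : ℕ)
    (hk : k + 2 ≤ r) : (d : ℝ) ^ (k + 2) - 2 * (d : ℝ) ^ k ≤ delta G (k + 2) := by
  obtain ⟨x, y, hxy, h'⟩ := exists_delta_eq hG (k + 2)
  rw [h']
  exact card_level_ge hG hd h hxy k hk

/-- From level 2 on, the loss `2 * d ^ (i-2)` is the fraction `2 / d^2` of `d ^ i`; levels 0 and 1
lose nothing. One factor thus serves every `i`. -/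
lemma mul_pow_le_delta [Nonempty V] (hG : IsReg G (d + 1)) (hd : 1 ≤ d) (h : SparseBalls G r)
    (i : ℕ) (hi : i ≤ r) : (1 - 2 / (d : ℝ) ^ 2) * (d : ℝ) ^ i ≤ delta G i := by
  have hd0 : (0 : ℝ) < d := by exact_mod_cast hd
  have hc : (1 - 2 / (d : ℝ) ^ 2) ≤ 1 := by
    have : 0 ≤ 2 / (d : ℝ) ^ 2 := by positivity
    linarith
  obtain ⟨x, y, hxy, h'⟩ := exists_delta_eq hG i
  match i with
  | 0 =>
    rw [h', level_zero]
    simpa using hc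
  | 1 =>
    rw [h', card_level_one hG hxy]
    simp only [Nat.add_sub_cancel, pow_one]
    exact mul_le_of_le_one_left hd0.le hc
  | k + 2 =>
    refine le_trans (le_of_eq ?_) (le_delta hG hd h k hi)
    field_simp
    ring

lemma rpow_two_div {b : ℝ} (hb : 0 ≤ b) (hr : 1 ≤ r) :
    (Real.sqrt (b ^ r)) ^ (2 / (r : ℝ)) = b := by
  have hr0 : (r : ℝ) ≠ 0 := by
    have : (1 : ℝ) ≤ r := by exact_mod_cast hr
    linarith
  rw [Real.sqrt_eq_rpow, ← Real.rpow_natCast, ← Real.rpow_mul hb, ← Real.rpow_mul hb]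
  have : (r : ℝ) * (1 / 2) * (2 / (r : ℝ)) = 1 := by field_simp
  rw [this, Real.rpow_one]

lemma dHat_le [Nonempty V] (hG : IsReg G (d + 1)) (hr : 1 ≤ r) : dHat G r ≤ d := by
  rw [← rpow_two_div (Nat.cast_nonneg d) hr]
  unfold dHat
  apply Real.rpow_le_rpow (by positivity) _ (by positivity)
  have h1 : ∑ i ∈ Finset.range (r + 1), Real.sqrt ((delta G i : ℝ) * (delta G (r - i) : ℝ))
      ≤ ∑ i ∈ Finset.range (r + 1), Real.sqrt ((d : ℝ) ^ r) := by
    apply Finset.sum_le_sum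
    intro i hi
    apply Real.sqrt_le_sqrt
    have hi' : i ≤ r := by
      have := Finset.mem_range.1 hi
      omega
    calc (delta G i : ℝ) * (delta G (r - i) : ℝ) ≤ (d : ℝ) ^ i * (d : ℝ) ^ (r - i) := by
          gcongr
          · exact delta_le hG i
          · exact delta_le hG (r - i)
      _ = (d : ℝ) ^ r := by rw [← pow_add, Nat.add_sub_cancel' hi']
  rw [Finset.sum_const, Finset.card_range, nsmul_eq_mul] at h1
  push_cast at h1
  rw [div_mul_eq_mul_div, one_mul, div_le_iff₀ (by positivity)]
  linarith

/-- Each product under the root is at least `c^2 * d^r`, hence at least `(c * d)^r` because `0 ≤ c ≤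
1` and `r ≥ 2`; the exponent `2/r` then returns `c * d`. -/
lemma le_dHat [Nonempty V] (hG : IsReg G (d + 1)) (hd : 2 ≤ d) (h : SparseBalls G r)
    (hr : 2 ≤ r) : (1 - 2 / (d : ℝ) ^ 2) * d ≤ dHat G r := by
  set c : ℝ := 1 - 2 / (d : ℝ) ^ 2 with hc
  have hd2 : (2 : ℝ) ≤ d := by exact_mod_cast hd
  have hc0 : 0 ≤ c := by
    rw [hc, sub_nonneg, div_le_one (by positivity)]
    nlinarith
  have hc1 : c ≤ 1 := by
    have : 0 ≤ 2 / (d : ℝ) ^ 2 := by positivity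
    linarith
  rw [← rpow_two_div (mul_nonneg hc0 (Nat.cast_nonneg d)) (by omega : 1 ≤ r)]
  unfold dHat
  apply Real.rpow_le_rpow (by positivity) _ (by positivity)
  have h1 : ∑ i ∈ Finset.range (r + 1), Real.sqrt ((c * d) ^ r) ≤
      ∑ i ∈ Finset.range (r + 1), Real.sqrt ((delta G i : ℝ) * (delta G (r - i) : ℝ)) := by
    apply Finset.sum_le_sum
    intro i hi
    apply Real.sqrt_le_sqrt
    have hi' : i ≤ r := by
      have := Finset.mem_range.1 hi
      omega
    calc (c * d) ^ r = c ^ r * (d : ℝ) ^ r := mul_pow _ _ _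
      _ ≤ c ^ 2 * (d : ℝ) ^ r := by
          gcongr ?_ * _
          exact pow_le_pow_of_le_one hc0 hc1 hr
      _ = (c * (d : ℝ) ^ i) * (c * (d : ℝ) ^ (r - i)) := by
          rw [← Nat.add_sub_cancel' hi', pow_add, Nat.add_sub_cancel' hi']
          ring
      _ ≤ (delta G i : ℝ) * (delta G (r - i) : ℝ) := by
          gcongr
          · exact mul_pow_le_delta hG (by omega) h i hi'
          · exact mul_pow_le_delta hG (by omega) h (r - i) (by omega)
  rw [Finset.sum_const, Finset.card_range, nsmul_eq_mul] at h1
  push_cast at h1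
  rw [div_mul_eq_mul_div, one_mul, le_div_iff₀ (by positivity)]
  linarith

/-- The deterministic consequences of sparse balls in a regular graph. -/
lemma SparseBalls.conclusion [Nonempty V] (hG : IsReg G d) (hd : 1 ≤ d) (h : SparseBalls G r)
    (hr : 3 ≤ r) :
    (∀ x : V, AtMostOneCycle (G.induce (closedBall G x r))) ∧
      ((d : ℝ) - 1) ^ (r : ℤ) - 2 * ((d : ℝ) - 1) ^ ((r : ℤ) - 2) ≤ (delta G r : ℝ) ∧
      |dHat G r - (d : ℝ)| ≤ 3 / (d : ℝ) * (d : ℝ) := by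
  obtain ⟨D, rfl⟩ : ∃ D, d = D + 1 := ⟨d - 1, by omega⟩
  have hcast : (((D + 1 : ℕ) : ℝ)) - 1 = D := by push_cast; ring
  refine ⟨h.atMostOneCycle, ?_, ?_⟩
  · rw [hcast]
    obtain ⟨k, rfl⟩ : ∃ k, r = k + 2 := ⟨r - 2, by omega⟩
    have h1 : (((k + 2 : ℕ) : ℤ) - 2) = (k : ℤ) := by push_cast; ring
    rw [h1, zpow_natCast, zpow_natCast]
    rcases Nat.eq_zero_or_pos D with rfl | hD
    · have hk : k ≠ 0 := by omega
      simp [hk]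
    · exact le_delta hG hD h k le_rfl
  · have hD1 : (((D + 1 : ℕ) : ℝ)) ≠ 0 := by positivity
    rw [div_mul_cancel₀ _ hD1]
    have h1 := dHat_le hG (by omega : 1 ≤ r)
    push_cast
    rw [abs_le]
    refine ⟨?_, by linarith⟩
    -- For degree at most 3 the bound is trivial, since `dHat` is nonnegative.
    rcases le_or_gt D 2 with hD | hD
    · have h2 : (0 : ℝ) ≤ dHat G r := by
        unfold dHat
        positivity
      have h3 : (D : ℝ) ≤ 2 := by exact_mod_cast hD
      linarith
    · have h2 := le_dHat hG (by omega : 2 ≤ D) h (by omega)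
      have h3 : (3 : ℝ) ≤ D := by exact_mod_cast hD
      have h4 : (1 - 2 / (D : ℝ) ^ 2) * D = D - 2 / D := by field_simp
      have h5 : 2 / (D : ℝ) ≤ 1 := by
        rw [div_le_one (by linarith)]
        linarith
      linarith

end Delta

/-! ### Explorations of dense balls and the first moment bound -/

section Exploration

open Classical

/-- The moves of an exploration: step to a new vertex, jump to a known vertex, or reveal a new
edge to a known vertex. -/
inductive Move
  | step
  | jump
  | chord

variable {V : Type*}

/-- The graph `G` admits an exploration with the given moves, starting at the vertex `c` with known
vertices `L` and known edges `F`. -/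
def Explores (G : SimpleGraph V) : List Move → V → Finset V → Finset (Sym2 V) → Prop
  | [], _, _, _ => True
  | Move.step :: w, c, L, F =>
      ∃ v, v ∉ L ∧ G.Adj c v ∧ Explores G w v (insert v L) (insert s(c, v) F)
  | Move.jump :: w, _, L, F => ∃ u ∈ L, Explores G w u L F
  | Move.chord :: w, c, L, F =>
      ∃ u ∈ L, s(c, u) ∉ F ∧ G.Adj c u ∧ Explores G w c L (insert s(c, u) F)

/-- Jump to a known vertex and make `k` steps. -/
def branch (k : ℕ) (w : List Move) : List Move :=
  Move.jump :: (List.replicate k Move.step ++ w)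

/-- The moves that reveal two branches and an edge between their ends. -/
def ear (k l : ℕ) (w : List Move) : List Move :=
  branch k (branch l (Move.chord :: w))

/-- Exploring the tree path towards a vertex at distance `k` from the root. -/
lemma exists_branch {G : SimpleGraph V} {x : V} {r : ℕ} {par : V → V} {T : Finset (Sym2 V)}
    (hpar : ∀ v, ∀ k : ℕ, k + 1 ≤ r → G.edist x v = ((k + 1 : ℕ) : ℕ∞) →
      G.Adj (par v) v ∧ G.edist x (par v) = (k : ℕ∞) ∧ s(par v, v) ∈ T)
    (k : ℕ) (hk : k ≤ r) : ∀ a, G.edist x a = (k : ℕ∞) → ∀ L F, x ∈ L →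
      ∃ k' ≤ k, ∃ L' F', L ⊆ L' ∧ a ∈ L' ∧ F' ⊆ F ∪ T ∧
        (∀ v ∈ L', v ∈ L ∨ G.edist x v ≤ (k : ℕ∞)) ∧
        ∀ w c, Explores G w a L' F' → Explores G (branch k' w) c L F := by
  induction k with
  | zero =>
    intro a ha L F hx
    have : x = a := by simpa using ha
    subst this
    exact ⟨0, le_rfl, L, F, subset_rfl, hx, Finset.subset_union_left, fun v hv => Or.inl hv,
      fun w c h => ⟨x, hx, h⟩⟩
  | succ k ih =>
    intro a ha L F hx
    -- Steps must reach new vertices, so the branch starts at the last vertex of the tree path that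
    -- is already known.
    by_cases haL : a ∈ L
    · exact ⟨0, Nat.zero_le _, L, F, subset_rfl, haL, Finset.subset_union_left,
        fun v hv => Or.inl hv, fun w c h => ⟨a, haL, h⟩⟩
    obtain ⟨h1, h2, h3⟩ := hpar a k hk ha
    obtain ⟨k', hk', L', F', hL, hpa, hF, hdist, hext⟩ := ih (by omega) (par a) h2 L F hx
    refine ⟨k' + 1, by omega, insert a L', insert s(par a, a) F',
      hL.trans (Finset.subset_insert _ _), Finset.mem_insert_self _ _, ?_, ?_, ?_⟩
    · exact Finset.insert_subset (Finset.mem_union_right _ h3) hF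
    · intro v hv
      rcases Finset.mem_insert.1 hv with rfl | hv
      · exact Or.inr ha.le
      · refine (hdist v hv).imp id fun h => h.trans ?_
        exact_mod_cast Nat.le_succ k
    · intro w c h
      -- Vertices added so far are at distance at most `k` from `x`, whereas `a` is at distance `k +
      -- 1`.
      have haL' : a ∉ L' := fun hcon => by
        rcases hdist a hcon with h4 | h4
        · exact haL h4
        · rw [ha] at h4
          have : k + 1 ≤ k := by exact_mod_cast h4
          omega
      have h5 := hext (Move.step :: w) c ⟨a, haL', h1, h⟩
      rw [branch, List.replicate_succ', List.append_assoc]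
      exact h5

/-- A ball that spans more edges than it has vertices admits an exploration with two ears. -/
lemma exists_explores_of_not_sparseBalls [Fintype V] {G : SimpleGraph V} {r : ℕ}
    (h : ¬ SparseBalls G r) :
    ∃ x : V, ∃ k₁ ≤ r, ∃ k₂ ≤ r, ∃ k₃ ≤ r, ∃ k₄ ≤ r,
      Explores G (ear k₁ k₂ (ear k₃ k₄ [])) x {x} ∅ := by
  simp only [SparseBalls, not_forall, not_le] at h
  obtain ⟨x, i, hir, hlt⟩ := h
  set B := ballFinset G x i with hB
  have hpar : ∀ v, ∃ u, ∀ k : ℕ, G.edist x v = ((k + 1 : ℕ) : ℕ∞) →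
      G.Adj u v ∧ G.edist x u = (k : ℕ∞) := by
    intro v
    by_cases hv : ∃ k : ℕ, G.edist x v = ((k + 1 : ℕ) : ℕ∞)
    · obtain ⟨k, hk⟩ := hv
      obtain ⟨u, huv, hu⟩ := exists_adj_edist_eq hk
      refine ⟨u, fun l hl => ⟨huv, ?_⟩⟩
      have : k + 1 = l + 1 := by exact_mod_cast hk.symm.trans hl
      rw [hu, (by omega : k = l)]
    · exact ⟨v, fun k hk => absurd ⟨k, hk⟩ hv⟩
  choose par hpar using hpar
  set T := (B.erase x).image (fun v => s(par v, v)) with hT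
  have hxB : x ∈ B := by simp [hB, mem_ballFinset]
  have hpar' : ∀ v, ∀ k : ℕ, k + 1 ≤ i → G.edist x v = ((k + 1 : ℕ) : ℕ∞) →
      G.Adj (par v) v ∧ G.edist x (par v) = (k : ℕ∞) ∧ s(par v, v) ∈ T := by
    intro v k hk hv
    refine ⟨(hpar v k hv).1, (hpar v k hv).2, Finset.mem_image_of_mem _ ?_⟩
    rw [Finset.mem_erase, hB, mem_ballFinset, hv]
    refine ⟨?_, by exact_mod_cast hk⟩
    rintro rfl
    rw [SimpleGraph.edist_self] at hv
    have : 0 = k + 1 := by exact_mod_cast hv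
    omega
  have hTcard : T.card + 1 ≤ B.card := by
    have h1 : T.card ≤ (B.erase x).card := Finset.card_image_le
    have h2 := Finset.card_erase_add_one hxB
    omega
  -- At least `|B| + 1` edges face at most `|B| - 1` tree edges.
  have htwo : 1 < (edgesIn G B \ T).card := by
    have := Finset.le_card_sdiff T (edgesIn G B)
    omega
  have hbranch : ∀ a ∈ B, ∀ L F, x ∈ L → ∃ k ≤ r, ∃ L' F', L ⊆ L' ∧ a ∈ L' ∧ F' ⊆ F ∪ T ∧
      ∀ w c, Explores G w a L' F' → Explores G (branch k w) c L F := by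
    intro a ha L F hx
    rw [hB, mem_ballFinset] at ha
    obtain ⟨k, hk⟩ := ENat.ne_top_iff_exists.1
      (ne_top_of_le_ne_top (ENat.natCast_ne_top i) ha)
    have hki : k ≤ i := by
      rw [← hk] at ha
      exact_mod_cast ha
    obtain ⟨k', hk', L', F', h1, h2, h3, _, h4⟩ := exists_branch hpar' k hki a hk.symm L F hx
    exact ⟨k', by omega, L', F', h1, h2, h3, h4⟩
  have hear : ∀ e ∈ edgesIn G B, ∀ L F, x ∈ L → e ∉ F ∪ T → ∃ k ≤ r, ∃ l ≤ r, ∃ u L' F',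
      x ∈ L' ∧ F' ⊆ insert e (F ∪ T) ∧
      ∀ w c, Explores G w u L' F' → Explores G (ear k l w) c L F := by
    intro e he L F hx heF
    induction e with
    | h a b =>
      rw [mem_edgesIn] at he
      obtain ⟨k, hk, L₁, F₁, h1, h2, h3, h4⟩ := hbranch a he.2.1 L F hx
      obtain ⟨l, hl, L₂, F₂, h5, h6, h7, h8⟩ := hbranch b he.2.2 L₁ F₁ (h1 hx)
      have hF₂ : F₂ ⊆ F ∪ T := h7.trans (Finset.union_subset h3 Finset.subset_union_right)
      refine ⟨k, hk, l, hl, b, L₂, insert s(b, a) F₂, h5 (h1 hx), ?_, fun w c h => ?_⟩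
      · rw [Sym2.eq_swap]
        exact Finset.insert_subset_insert _ hF₂
      · refine h4 _ c (h8 _ _ ⟨a, h5 h2, ?_, he.1.symm, h⟩)
        rw [Sym2.eq_swap]
        exact fun hcon => heF (hF₂ hcon)
  obtain ⟨e, he, f, hf, hef⟩ := Finset.one_lt_card.1 htwo
  rw [Finset.mem_sdiff] at he hf
  obtain ⟨k₁, hk₁, k₂, hk₂, u, L, F, hxL, hF, h1⟩ :=
    hear e he.1 {x} ∅ (Finset.mem_singleton_self x) (by simpa using he.2)
  obtain ⟨k₃, hk₃, k₄, hk₄, u', L', F', -, -, h2⟩ := hear f hf.1 L F hxL (by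
    intro hcon
    rcases Finset.mem_union.1 hcon with h3 | h3
    · rcases Finset.mem_insert.1 (hF h3) with h4 | h4
      · exact hef h4.symm
      · exact hf.2 (by simpa using h4)
    · exact hf.2 h3)
  exact ⟨x, k₁, hk₁, k₂, hk₂, k₃, hk₃, k₄, hk₄, h1 _ _ (h2 _ _ trivial)⟩

/-- The number of graphs of the family `R` with the property `P`. -/
noncomputable def countWhere (R : Finset (SimpleGraph V)) (P : SimpleGraph V → Prop) : ℝ :=
  ((R.filter P).card : ℝ)

/-- The union bound. -/
lemma countWhere_le_card_mul {ι : Type*} {R : Finset (SimpleGraph V)} (I : Finset ι)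
    {P : SimpleGraph V → Prop} (Q : ι → SimpleGraph V → Prop) (b : ℝ)
    (h₁ : ∀ G, P G → ∃ i ∈ I, Q i G) (h₂ : ∀ i ∈ I, countWhere R (Q i) ≤ b) :
    countWhere R P ≤ I.card * b := by
  have h₃ : R.filter P ⊆ I.biUnion fun i => R.filter (Q i) := by
    intro G hG
    rw [Finset.mem_filter] at hG
    obtain ⟨i, hi, hQ⟩ := h₁ G hG.2
    exact Finset.mem_biUnion.2 ⟨i, hi, Finset.mem_filter.2 ⟨hG.1, hQ⟩⟩
  calc countWhere R P ≤ ∑ i ∈ I, countWhere R (Q i) := by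
        unfold countWhere
        exact_mod_cast (Finset.card_le_card h₃).trans Finset.card_biUnion_le
    _ ≤ ∑ _i ∈ I, b := Finset.sum_le_sum h₂
    _ = I.card * b := by rw [Finset.sum_const, nsmul_eq_mul]

/-- The number of graphs of the family `R` that contain all edges of `F`. -/
noncomputable def countContaining (R : Finset (SimpleGraph V)) (F : Finset (Sym2 V)) : ℝ :=
  countWhere R fun G => ∀ e ∈ F, e ∈ G.edgeSet

/-- The factor by which a move changes the bound for the number of explorable graphs. -/
noncomputable def moveWeight (n M q : ℝ) : Move → ℝ
  | Move.step => n * q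
  | Move.jump => M
  | Move.chord => M * q

variable [Fintype V]

/-- First moment bound for explorations: if every new edge costs a factor `q`, then the number of
graphs with a given exploration is at most the product of the weights of its moves. -/
lemma card_explores_le {R : Finset (SimpleGraph V)} {q : ℝ} {M : ℕ} (hq : 0 ≤ q)
    (hR : ∀ F : Finset (Sym2 V), F.card ≤ M → ∀ e, e ∉ F → ¬ e.IsDiag →
      countContaining R (insert e F) ≤ q * countContaining R F) (w : List Move) :
    ∀ (c : V) (L : Finset V) (F : Finset (Sym2 V)), c ∈ L → (∀ e ∈ F, ∀ v ∈ e, v ∈ L) →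
      L.card + w.length ≤ M → F.card + w.length ≤ M →
      countWhere R (fun G => (∀ e ∈ F, e ∈ G.edgeSet) ∧ Explores G w c L F)
        ≤ (w.map (moveWeight (Fintype.card V) M q)).prod * countContaining R F := by
  have hnn : ∀ w : List Move, 0 ≤ (w.map (moveWeight (Fintype.card V) M q)).prod := by
    intro w
    apply List.prod_nonneg
    intro t ht
    obtain ⟨m, -, rfl⟩ := List.mem_map.1 ht
    cases m <;> simp only [moveWeight] <;> positivity
  have hN : ∀ F, 0 ≤ countContaining R F := fun F => by
    unfold countContaining countWhere
    positivity
  induction w with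
  | nil =>
    intro c L F _ _ _ _
    simp [Explores, countContaining]
  | cons m w ih =>
    intro c L F hc hF hL hM
    rw [List.length_cons] at hL hM
    rw [List.map_cons, List.prod_cons]
    cases m with
    | step =>
      have hb := countWhere_le_card_mul (R := R) (Finset.univ.filter fun v => v ∉ L)
        (fun v (G : SimpleGraph V) => (∀ e ∈ insert s(c, v) F, e ∈ G.edgeSet) ∧
          Explores G w v (insert v L) (insert s(c, v) F))
        ((w.map (moveWeight (Fintype.card V) M q)).prod * (q * countContaining R F))
        (P := fun G => (∀ e ∈ F, e ∈ G.edgeSet) ∧ Explores G (Move.step :: w) c L F) ?_ ?_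
      · refine hb.trans ?_
        have h1 : (((Finset.univ.filter fun v => v ∉ L).card : ℕ) : ℝ) ≤ Fintype.card V := by
          exact_mod_cast Finset.card_le_univ _
        calc _ ≤ (Fintype.card V : ℝ) * ((w.map (moveWeight (Fintype.card V) M q)).prod
                * (q * countContaining R F)) :=
              mul_le_mul_of_nonneg_right h1
                (mul_nonneg (hnn w) (mul_nonneg hq (hN F)))
          _ = _ := by simp only [moveWeight]; ring
      · rintro G ⟨h1, v, hv, hadj, h2⟩
        refine ⟨v, by simpa using hv, ?_, h2⟩
        intro e he
        rcases Finset.mem_insert.1 he with rfl | he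
        · exact hadj
        · exact h1 e he
      · intro v hv
        have hv' : v ∉ L := by simpa using hv
        have hcv : s(c, v) ∉ F := fun h => hv' (hF _ h v (Sym2.mem_mk_right _ _))
        refine (ih v (insert v L) (insert s(c, v) F) (Finset.mem_insert_self _ _) ?_ ?_ ?_).trans ?_
        · intro e he u hu
          rcases Finset.mem_insert.1 he with rfl | he
          · rcases Sym2.mem_iff.1 hu with rfl | rfl
            · exact Finset.mem_insert_of_mem hc
            · exact Finset.mem_insert_self _ _
          · exact Finset.mem_insert_of_mem (hF e he u hu)
        · rw [Finset.card_insert_of_notMem hv']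
          omega
        · rw [Finset.card_insert_of_notMem hcv]
          omega
        · refine mul_le_mul_of_nonneg_left (hR F (by omega) _ hcv ?_) (hnn w)
          rw [Sym2.mk_isDiag_iff]
          rintro rfl
          exact hv' hc
    | jump =>
      have hb := countWhere_le_card_mul (R := R) L
        (fun v (G : SimpleGraph V) => (∀ e ∈ F, e ∈ G.edgeSet) ∧ Explores G w v L F)
        ((w.map (moveWeight (Fintype.card V) M q)).prod * countContaining R F)
        (P := fun G => (∀ e ∈ F, e ∈ G.edgeSet) ∧ Explores G (Move.jump :: w) c L F) ?_ ?_
      · refine hb.trans ?_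
        rw [moveWeight, mul_assoc]
        apply mul_le_mul_of_nonneg_right _ (mul_nonneg (hnn w) (hN F))
        exact_mod_cast (by omega : L.card ≤ M)
      · rintro G ⟨h1, v, hv, h2⟩
        exact ⟨v, hv, h1, h2⟩
      · intro v hv
        exact ih v L F hv hF (by omega) (by omega)
    | chord =>
      have hb := countWhere_le_card_mul (R := R) (L.filter fun u => s(c, u) ∉ F ∧ c ≠ u)
        (fun v (G : SimpleGraph V) => (∀ e ∈ insert s(c, v) F, e ∈ G.edgeSet) ∧
          Explores G w c L (insert s(c, v) F))
        ((w.map (moveWeight (Fintype.card V) M q)).prod * (q * countContaining R F))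
        (P := fun G => (∀ e ∈ F, e ∈ G.edgeSet) ∧ Explores G (Move.chord :: w) c L F) ?_ ?_
      · refine hb.trans ?_
        have h1 : (((L.filter fun u => s(c, u) ∉ F ∧ c ≠ u).card : ℕ) : ℝ) ≤ M := by
          exact_mod_cast (Finset.card_filter_le _ _).trans (by omega)
        calc _ ≤ (M : ℝ) * ((w.map (moveWeight (Fintype.card V) M q)).prod
                * (q * countContaining R F)) :=
              mul_le_mul_of_nonneg_right h1
                (mul_nonneg (hnn w) (mul_nonneg hq (hN F)))
          _ = _ := by simp only [moveWeight]; ring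
      · rintro G ⟨h1, u, hu, huF, hadj, h2⟩
        refine ⟨u, Finset.mem_filter.2 ⟨hu, huF, hadj.ne⟩, ?_, h2⟩
        intro e he
        rcases Finset.mem_insert.1 he with rfl | he
        · exact hadj
        · exact h1 e he
      · intro u hu
        obtain ⟨huL, huF, hcu⟩ := Finset.mem_filter.1 hu
        refine (ih c L (insert s(c, u) F) hc ?_ (by omega) ?_).trans ?_
        · intro e he v hv
          rcases Finset.mem_insert.1 he with rfl | he
          · rcases Sym2.mem_iff.1 hv with rfl | rfl
            · exact hc
            · exact huL
          · exact hF e he v hv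
        · rw [Finset.card_insert_of_notMem huF]
          omega
        · exact mul_le_mul_of_nonneg_left (hR F (by omega) _ huF (by simpa using hcu)) (hnn w)

/-- The number of graphs with a ball that spans more edges than it has vertices. -/
lemma card_not_sparseBalls_le {R : Finset (SimpleGraph V)} {q : ℝ} {r : ℕ} (hq : 0 ≤ q)
    (hnq : 1 ≤ Fintype.card V * q)
    (hR : ∀ F : Finset (Sym2 V), F.card ≤ 4 * r + 7 → ∀ e, e ∉ F → ¬ e.IsDiag →
      countContaining R (insert e F) ≤ q * countContaining R F) :
    countWhere R (fun G => ¬ SparseBalls G r) ≤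
      Fintype.card V * ((r + 1 : ℝ) ^ 4 * ((4 * r + 7 : ℝ) ^ 6 * q ^ 2 *
        (Fintype.card V * q) ^ (4 * r))) * R.card := by
  set t : ℝ := Fintype.card V * q with ht
  set b : ℝ := (4 * r + 7 : ℝ) ^ 6 * q ^ 2 * t ^ (4 * r) * R.card with hb
  set K := Finset.range (r + 1) with hK
  let I : Finset (V × ℕ × ℕ × ℕ × ℕ) := Finset.univ ×ˢ K ×ˢ K ×ˢ K ×ˢ K
  let Q : V × ℕ × ℕ × ℕ × ℕ → SimpleGraph V → Prop := fun p G =>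
    Explores G (ear p.2.1 p.2.2.1 (ear p.2.2.2.1 p.2.2.2.2 [])) p.1 {p.1} ∅
  have hcover : ∀ G, ¬ SparseBalls G r → ∃ p ∈ I, Q p G := by
    intro G hG
    obtain ⟨x, k₁, hk₁, k₂, hk₂, k₃, hk₃, k₄, hk₄, h⟩ := exists_explores_of_not_sparseBalls hG
    refine ⟨(x, k₁, k₂, k₃, k₄), ?_, h⟩
    simp only [I, hK, Finset.mem_product, Finset.mem_univ, Finset.mem_range, true_and]
    omega
  have hterm : ∀ p ∈ I, countWhere R (Q p) ≤ b := by
    rintro ⟨x, k₁, k₂, k₃, k₄⟩ hp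
    simp only [I, hK, Finset.mem_product, Finset.mem_univ, Finset.mem_range, true_and] at hp
    -- The word has at most `4r` steps, four jumps and two chords; with the root this gives `4r +
    -- 7`. Jumps and chords contribute the sixth power of this bound and `q ^ 2`. As `t ≥ 1`, the
    -- exponent of `t` may be raised to `4r`.
    have h1 := card_explores_le (M := 4 * r + 7) hq hR (ear k₁ k₂ (ear k₃ k₄ [])) x {x} ∅
      (Finset.mem_singleton_self x) (by simp)
      (by simp [ear, branch]; omega) (by simp [ear, branch]; omega)
    simp only [Finset.notMem_empty, false_imp_iff, implies_true, true_and] at h1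
    refine h1.trans ?_
    have h2 : countContaining R ∅ = R.card := by simp [countContaining, countWhere]
    have h3 : ((ear k₁ k₂ (ear k₃ k₄ [])).map
        (moveWeight (Fintype.card V) ((4 * r + 7 : ℕ) : ℝ) q)).prod
        = (4 * r + 7 : ℝ) ^ 6 * q ^ 2 * t ^ (k₁ + k₂ + k₃ + k₄) := by
      simp only [ear, branch, List.map_cons, List.map_append, List.map_replicate,
        List.prod_cons, List.prod_append, List.prod_replicate, List.map_nil, List.prod_nil,
        moveWeight]
      rw [← ht]
      push_cast
      ring
    rw [h2, h3, hb]
    gcongr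
    omega
  refine (countWhere_le_card_mul I Q b hcover hterm).trans (le_of_eq ?_)
  simp only [I, hK, Finset.card_product, Finset.card_univ, Finset.card_range]
  rw [hb]
  push_cast
  ring

end Exploration

/-! ### Switchings and the cost of one edge -/

section Switching

open Classical

variable {V : Type*}

/-- The graph obtained from `G` by replacing the edges `uv` and `ab` by `ua` and `vb`. -/
def switch (G : SimpleGraph V) (u v a b : V) : SimpleGraph V :=
  SimpleGraph.fromEdgeSet ((G.edgeSet \ {s(u, v), s(a, b)}) ∪ {s(u, a), s(v, b)})

lemma switch_adj {G : SimpleGraph V} {u v a b p q : V} (hua : u ≠ a) (hvb : v ≠ b) :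
    (switch G u v a b).Adj p q ↔
      (G.Adj p q ∧ s(p, q) ≠ s(u, v) ∧ s(p, q) ≠ s(a, b)) ∨ s(p, q) = s(u, a)
        ∨ s(p, q) = s(v, b) := by
  simp only [switch, SimpleGraph.fromEdgeSet_adj, Set.mem_union, Set.mem_sdiff,
    SimpleGraph.mem_edgeSet, Set.mem_insert_iff, Set.mem_singleton_iff, not_or]
  constructor
  · exact fun h => h.1
  · refine fun h => ⟨h, ?_⟩
    rcases h with h | h | h
    · exact h.1.ne
    · rintro rfl
      rcases Sym2.eq_iff.1 h with h | h <;> exact hua (by rw [← h.1, ← h.2])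
    · rintro rfl
      rcases Sym2.eq_iff.1 h with h | h <;> exact hvb (by rw [← h.1, ← h.2])

/-- The pair `(a, b)` can be switched with the edge `uv` of `G`. -/
def Switchable (G : SimpleGraph V) (u v : V) (p : V × V) : Prop :=
  G.Adj p.1 p.2 ∧ (¬ G.Adj u p.1 ∧ u ≠ p.1) ∧ (¬ G.Adj v p.2 ∧ v ≠ p.2)

/-- A switch can be undone. -/
lemma switch_injective {G H : SimpleGraph V} {u v a b : V} (huv : G.Adj u v) (huv' : H.Adj u v)
    (hG : Switchable G u v (a, b)) (hH : Switchable H u v (a, b))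
    (h : switch G u v a b = switch H u v a b) : G = H := by
  obtain ⟨hab, ⟨hua, hua'⟩, hvb, hvb'⟩ := hG
  obtain ⟨kab, ⟨kua, -⟩, kvb, -⟩ := hH
  simp only at hab hua hua' hvb hvb' kab kua kvb
  ext p q
  have h1 : (switch G u v a b).Adj p q ↔ (switch H u v a b).Adj p q := by rw [h]
  rw [switch_adj hua' hvb', switch_adj hua' hvb'] at h1
  by_cases h2 : s(p, q) = s(u, v)
  · have e1 : G.Adj p q := by
      rw [← SimpleGraph.mem_edgeSet, h2]
      exact huv
    have e2 : H.Adj p q := by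
      rw [← SimpleGraph.mem_edgeSet, h2]
      exact huv'
    exact iff_of_true e1 e2
  by_cases h3 : s(p, q) = s(a, b)
  · have e1 : G.Adj p q := by
      rw [← SimpleGraph.mem_edgeSet, h3]
      exact hab
    have e2 : H.Adj p q := by
      rw [← SimpleGraph.mem_edgeSet, h3]
      exact kab
    exact iff_of_true e1 e2
  by_cases h4 : s(p, q) = s(u, a)
  · have e1 : ¬ G.Adj p q := by
      rw [← SimpleGraph.mem_edgeSet, h4]
      exact hua
    have e2 : ¬ H.Adj p q := by
      rw [← SimpleGraph.mem_edgeSet, h4]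
      exact kua
    exact iff_of_false e1 e2
  by_cases h5 : s(p, q) = s(v, b)
  · have e1 : ¬ G.Adj p q := by
      rw [← SimpleGraph.mem_edgeSet, h5]
      exact hvb
    have e2 : ¬ H.Adj p q := by
      rw [← SimpleGraph.mem_edgeSet, h5]
      exact kvb
    exact iff_of_false e1 e2
  simpa [h2, h3, h4, h5] using h1

variable [Fintype V]

/-- Switching preserves regularity. -/
lemma IsReg.switch {G : SimpleGraph V} {d : ℕ} (hG : IsReg G d) {u v a b : V} (huv : G.Adj u v)
    (h : Switchable G u v (a, b)) : IsReg (switch G u v a b) d := by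
  obtain ⟨hab, ⟨hua, hua'⟩, hvb, hvb'⟩ := h
  simp only at hab hua hua' hvb hvb'
  have hav : a ≠ v := by
    rintro rfl
    exact hua huv
  have hbu : b ≠ u := by
    rintro rfl
    exact hvb huv.symm
  -- Each of `u`, `v`, `a`, `b` exchanges one neighbour `x` for a new one `y`.
  have hcard : ∀ p x y, G.Adj p x → ¬ G.Adj p y →
      (∀ q, (GraphPowering.switch G u v a b).Adj p q ↔ q = y ∨ q ≠ x ∧ G.Adj p q) →
      (Finset.univ.filter ((GraphPowering.switch G u v a b).Adj p)).card = d := by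
    intro p x y hx hy hq
    have h1 : Finset.univ.filter ((GraphPowering.switch G u v a b).Adj p)
        = insert y ((Finset.univ.filter (G.Adj p)).erase x) := by
      ext q
      simp [hq]
    rw [h1, Finset.card_insert_of_notMem (by simp [hy]),
      Finset.card_erase_add_one (by simpa using hx), hG p]
  have huv' := huv.ne
  have hab' := hab.ne
  intro p
  by_cases hp : p = u
  · subst hp
    refine hcard p v a huv hua fun q => ?_
    rw [switch_adj hua' hvb']
    simp only [Sym2.eq_iff, ne_eq]
    grind
  by_cases hp2 : p = v
  · subst hp2
    refine hcard p u b huv.symm hvb fun q => ?_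
    rw [switch_adj hua' hvb']
    simp only [Sym2.eq_iff, ne_eq]
    grind
  by_cases hp3 : p = a
  · subst hp3
    refine hcard p b u hab (fun h => hua h.symm) fun q => ?_
    rw [switch_adj hua' hvb']
    simp only [Sym2.eq_iff, ne_eq]
    grind
  by_cases hp4 : p = b
  · subst hp4
    refine hcard p a v hab.symm (fun h => hvb h.symm) fun q => ?_
    rw [switch_adj hua' hvb']
    simp only [Sym2.eq_iff, ne_eq]
    grind
  · rw [← hG p]
    congr 1
    ext q
    rw [Finset.mem_filter, Finset.mem_filter, switch_adj hua' hvb']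
    simp only [Sym2.eq_iff, ne_eq]
    grind

/-- The number of darts that start in `W`. -/
lemma card_darts_from {G : SimpleGraph V} {d : ℕ} (hG : IsReg G d) (W : Finset V) :
    (Finset.univ.filter fun p : V × V => p.1 ∈ W ∧ G.Adj p.1 p.2).card = W.card * d := by
  have h1 : (Finset.univ.filter fun p : V × V => p.1 ∈ W ∧ G.Adj p.1 p.2)
      = (W.sigma fun a => Finset.univ.filter (G.Adj a)).map
        (Equiv.sigmaEquivProd V V).toEmbedding := by
    ext ⟨a, b⟩
    simp
  rw [h1, Finset.card_map, Finset.card_sigma, Finset.sum_congr rfl fun a _ => hG a,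
    Finset.sum_const, smul_eq_mul]

/-- Most darts of a regular graph can be switched with a given edge without destroying `F`. -/
lemma card_switchable_ge {G : SimpleGraph V} {d : ℕ} (hG : IsReg G d) (u v : V)
    (F : Finset (Sym2 V)) :
    Fintype.card V * d ≤ (Finset.univ.filter fun p : V × V =>
      Switchable G u v p ∧ s(p.1, p.2) ∉ F).card + (2 * F.card + 2 * ((d + 1) * d)) := by
  -- A dart `(a, b)` fails only if its edge is in `F`, or `a` is in the closed neighbourhood of `u`,
  -- or `b` in that of `v`.
  set good := Finset.univ.filter fun p : V × V => Switchable G u v p ∧ s(p.1, p.2) ∉ F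
  set inF := Finset.univ.filter fun p : V × V => s(p.1, p.2) ∈ F with hinF
  let nbr : V → Finset V := fun u => insert u (Finset.univ.filter (G.Adj u))
  have hnbr : ∀ u, (nbr u).card = d + 1 := fun u => by
    rw [Finset.card_insert_of_notMem (by simp), hG u]
  set near := Finset.univ.filter fun p : V × V => p.1 ∈ nbr u ∧ G.Adj p.1 p.2 with hnear
  set near' := Finset.univ.filter fun p : V × V => p.1 ∈ nbr v ∧ G.Adj p.1 p.2 with hnear'
  have h1 : near.card = (d + 1) * d := by rw [hnear, card_darts_from hG, hnbr]
  have h2 : (near'.map (Equiv.prodComm V V).toEmbedding).card = (d + 1) * d := by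
    rw [Finset.card_map, hnear', card_darts_from hG, hnbr]
  have h3 : inF.card ≤ 2 * F.card := by
    apply Finset.card_le_mul_card_image_of_maps_to (f := fun p : V × V => s(p.1, p.2))
    · intro p hp
      simpa [hinF] using hp
    · intro e _
      induction e with
      | h a b =>
        refine le_trans (Finset.card_le_card (t := {(a, b), (b, a)}) ?_) Finset.card_le_two
        rintro ⟨c, d⟩ hp
        have := (Finset.mem_filter.1 hp).2
        simp only [Sym2.eq_iff] at this
        simpa using this
  have h4 := card_darts_from hG Finset.univ
  rw [Finset.card_univ] at h4
  have hsub : (Finset.univ.filter fun p : V × V => p.1 ∈ Finset.univ ∧ G.Adj p.1 p.2) ⊆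
      good ∪ (inF ∪ (near ∪ near'.map (Equiv.prodComm V V).toEmbedding)) := by
    rintro ⟨a, b⟩ hp
    have hab : G.Adj a b := by simpa using hp
    by_contra hcon
    simp only [Finset.mem_union, not_or] at hcon
    obtain ⟨c1, c2, c3, c4⟩ := hcon
    have c2' : s(a, b) ∉ F := by simpa [hinF] using c2
    have c3' : ¬ (a = u ∨ G.Adj u a) := by
      intro h
      exact c3 (Finset.mem_filter.2 ⟨Finset.mem_univ _, by simpa [nbr] using h, hab⟩)
    have c4' : ¬ (b = v ∨ G.Adj v b) := by
      intro h
      exact c4 (Finset.mem_map.2 ⟨(b, a), Finset.mem_filter.2 ⟨Finset.mem_univ _,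
        by simpa [nbr] using h, hab.symm⟩, rfl⟩)
    rw [not_or] at c3' c4'
    exact c1 (Finset.mem_filter.2 ⟨Finset.mem_univ _,
      ⟨hab, ⟨c3'.2, Ne.symm c3'.1⟩, c4'.2, Ne.symm c4'.1⟩, c2'⟩)
  have h5 := Finset.card_le_card hsub
  have h6 := Finset.card_union_le good (inF ∪ (near ∪ near'.map (Equiv.prodComm V V).toEmbedding))
  have h7 := Finset.card_union_le inF (near ∪ near'.map (Equiv.prodComm V V).toEmbedding)
  have h8 := Finset.card_union_le near (near'.map (Equiv.prodComm V V).toEmbedding)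
  omega

/-- The `d`-regular graphs on the vertex set `V`. -/
noncomputable def regFamily (V : Type*) [Fintype V] (d : ℕ) : Finset (SimpleGraph V) :=
  Finset.univ.filter fun G => IsReg G d

/-- Revealing one more edge of a random regular graph costs a factor of about `d / n`. -/
lemma countContaining_insert_mul_le {d : ℕ} {F : Finset (Sym2 V)} {e : Sym2 V} (heF : e ∉ F)
    (he : ¬ e.IsDiag) :
    countContaining (regFamily V d) (insert e F)
      * (Fintype.card V * d - (2 * F.card + 2 * ((d + 1) * d)))
      ≤ d ^ 2 * countContaining (regFamily V d) F := by
  induction e with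
  | h u v =>
  set A := (regFamily V d).filter fun G => ∀ e ∈ insert s(u, v) F, e ∈ G.edgeSet with hA
  set A' := (regFamily V d).filter fun G => ∀ e ∈ F, e ∈ G.edgeSet with hA'
  let good : SimpleGraph V → Finset (V × V) := fun G => Finset.univ.filter fun p : V × V =>
      Switchable G u v p ∧ s(p.1, p.2) ∉ F
  let tgt : SimpleGraph V → Finset (V × V) := fun G =>
    (Finset.univ.filter (G.Adj u)) ×ˢ (Finset.univ.filter (G.Adj v))
  have hAmem : ∀ G ∈ A, IsReg G d ∧ G.Adj u v ∧ ∀ e ∈ F, e ∈ G.edgeSet := by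
    intro G hG
    obtain ⟨h1, h2⟩ := Finset.mem_filter.1 hG
    exact ⟨(Finset.mem_filter.1 h1).2, h2 _ (Finset.mem_insert_self _ _),
      fun e he => h2 e (Finset.mem_insert_of_mem he)⟩
  -- Double counting: the switched graph together with the dart determines `G`. In the switched
  -- graph `a` is a neighbour of `u` and `b` one of `v`, which leaves `d ^ 2` darts per graph.
  have hcard : (A.sigma good).card ≤ (A'.sigma tgt).card := by
    apply Finset.card_le_card_of_injOn (fun z => ⟨switch z.1 u v z.2.1 z.2.2, z.2⟩)
    · rintro ⟨G, a, b⟩ hz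
      obtain ⟨hG, hp⟩ := Finset.mem_sigma.1 (Finset.mem_coe.1 hz)
      obtain ⟨hreg, huv, hFG⟩ := hAmem G hG
      obtain ⟨-, hsw, habF⟩ := Finset.mem_filter.1 hp
      have hua := hsw.2.1.2
      have hvb := hsw.2.2.2
      simp only at hua hvb habF
      refine Finset.mem_coe.2 (Finset.mem_sigma.2 ⟨Finset.mem_filter.2
        ⟨Finset.mem_filter.2 ⟨Finset.mem_univ _, hreg.switch huv hsw⟩, ?_⟩, ?_⟩)
      · intro f hf
        induction f with
        | h p q =>
          rw [SimpleGraph.mem_edgeSet, switch_adj hua hvb]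
          refine Or.inl ⟨hFG _ hf, ?_, ?_⟩
          · rintro h
            exact heF (h ▸ hf)
          · rintro h
            exact habF (h ▸ hf)
      · simp only [tgt, Finset.mem_product, Finset.mem_filter, Finset.mem_univ, true_and]
        rw [switch_adj hua hvb, switch_adj hua hvb]
        simp
    · rintro ⟨G, a, b⟩ hz ⟨H, a', b'⟩ hz' h
      obtain ⟨hG, hp⟩ := Finset.mem_sigma.1 (Finset.mem_coe.1 hz)
      obtain ⟨hH, hp'⟩ := Finset.mem_sigma.1 (Finset.mem_coe.1 hz')
      simp only [Sigma.mk.injEq, heq_eq_eq, Prod.mk.injEq] at h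
      obtain ⟨h, rfl, rfl⟩ := h
      have := switch_injective (hAmem G hG).2.1 (hAmem H hH).2.1
        (Finset.mem_filter.1 hp).2.1 (Finset.mem_filter.1 hp').2.1 h
      subst this
      rfl
  rw [Finset.card_sigma, Finset.card_sigma] at hcard
  have h1 : ∑ G ∈ A', (tgt G).card = A'.card * d ^ 2 := by
    rw [Finset.sum_congr rfl (g := fun _ => d ^ 2), Finset.sum_const, smul_eq_mul]
    intro G hG
    have hreg := (Finset.mem_filter.1 (Finset.mem_filter.1 hG).1).2
    simp only [tgt]
    rw [Finset.card_product, hreg u, hreg v, sq]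
  have h2 : (A.card : ℝ) * (Fintype.card V * d - (2 * F.card + 2 * ((d + 1) * d)))
      ≤ ∑ G ∈ A, ((good G).card : ℝ) := by
    rw [← nsmul_eq_mul]
    apply Finset.card_nsmul_le_sum
    intro G hG
    have h3 := card_switchable_ge (hAmem G hG).1 u v F
    have h4 : (Fintype.card V * d : ℝ) ≤ (good G).card + (2 * F.card + 2 * ((d + 1) * d)) := by
      exact_mod_cast h3
    linarith
  have h5 : (∑ G ∈ A, ((good G).card : ℝ)) ≤ A'.card * (d : ℝ) ^ 2 := by
    rw [h1] at hcard
    exact_mod_cast hcard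
  have h6 : countContaining (regFamily V d) (insert s(u, v) F) = A.card := by
    simp only [countContaining, countWhere, hA]
    congr!
  have h7 : countContaining (regFamily V d) F = A'.card := by
    simp only [countContaining, countWhere, hA']
    congr!
  rw [h6, h7]
  linarith

end Switching

/-! ### Existence of regular graphs -/

section Existence

open Classical

/-- A symmetric set of `d` nonzero residues exists whenever `d < n` and `n * d` is even. -/
lemma exists_symmetric_finset {n d : ℕ} [NeZero n] (hdn : d < n) (h : Even (n * d)) :
    ∃ S : Finset (Fin n), (∀ s ∈ S, -s ∈ S) ∧ 0 ∉ S ∧ S.card = d := by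
  set k := d / 2 with hk
  have hpar : d = 2 * k ∨ d = 2 * k + 1 ∧ ∃ m, n = 2 * m := by
    rcases Nat.even_or_odd' d with ⟨c, hc | hc⟩
    · left
      omega
    · right
      refine ⟨by omega, ?_⟩
      rcases Nat.even_mul.1 h with h1 | h1
      · obtain ⟨m, hm⟩ := h1
        exact ⟨m, by omega⟩
      · obtain ⟨m, hm⟩ := h1
        omega
  -- The `k` residues on either side of 0, and the self-inverse residue `n/2` if `d` is odd.
  let p : ℕ → Prop := fun t => t ≠ 0 ∧ (t ≤ k ∨ n - k ≤ t ∨ (d = 2 * k + 1 ∧ 2 * t = n))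
  refine ⟨Finset.univ.filter fun s => p s.val, ?_, ?_, ?_⟩
  · intro s hs
    have hs' : p s.val := by simpa using hs
    have hlt := s.isLt
    have hneg : (-s).val = n - s.val := by
      rw [Fin.val_neg', Nat.mod_eq_of_lt]
      have := hs'.1
      omega
    simp only [Finset.mem_filter, Finset.mem_univ, true_and, p, hneg] at hs' ⊢
    omega
  · simp [p]
  · have h1 : (Finset.univ.filter fun s : Fin n => p s.val).map Fin.valEmbedding
        = (Finset.range n).filter p := by
      ext t
      simp only [Finset.mem_map, Finset.mem_filter, Finset.mem_univ, true_and,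
        Fin.valEmbedding_apply, Finset.mem_range]
      constructor
      · rintro ⟨s, hs, rfl⟩
        exact ⟨s.isLt, hs⟩
      · rintro ⟨ht, hp⟩
        exact ⟨⟨t, ht⟩, hp, rfl⟩
    rw [← Finset.card_map Fin.valEmbedding, h1]
    rcases hpar with hd | ⟨hd, m, hm⟩
    · have h2 : (Finset.range n).filter p = Finset.Icc 1 k ∪ Finset.Ico (n - k) n := by
        ext t
        simp only [Finset.mem_filter, Finset.mem_range, Finset.mem_union, Finset.mem_Icc,
          Finset.mem_Ico, p]
        omega
      rw [h2, Finset.card_union_of_disjoint, Nat.card_Icc, Nat.card_Ico]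
      · omega
      · rw [Finset.disjoint_left]
        intro t h3 h4
        simp only [Finset.mem_Icc, Finset.mem_Ico] at h3 h4
        omega
    · have h2 : (Finset.range n).filter p
          = insert m (Finset.Icc 1 k ∪ Finset.Ico (n - k) n) := by
        ext t
        simp only [Finset.mem_filter, Finset.mem_range, Finset.mem_union, Finset.mem_Icc,
          Finset.mem_Ico, Finset.mem_insert, p]
        omega
      rw [h2, Finset.card_insert_of_notMem, Finset.card_union_of_disjoint, Nat.card_Icc,
        Nat.card_Ico]
      · omega
      · rw [Finset.disjoint_left]
        intro t h3 h4
        simp only [Finset.mem_Icc, Finset.mem_Ico] at h3 h4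
        omega
      · simp only [Finset.mem_union, Finset.mem_Icc, Finset.mem_Ico]
        omega

/-- There is a `d`-regular graph on `n` vertices whenever `d < n` and `n * d` is even. -/
lemma exists_isReg {n d : ℕ} (hdn : d < n) (h : Even (n * d)) :
    ∃ G : SimpleGraph (Fin n), IsReg G d := by
  have : NeZero n := ⟨by omega⟩
  obtain ⟨S, hneg, h0, hcard⟩ := exists_symmetric_finset hdn h
  refine ⟨⟨fun i j => j - i ∈ S, ⟨fun i j hij => ?_⟩, ⟨fun i hi => h0 (by simpa using hi)⟩⟩, ?_⟩
  · rw [← neg_sub]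
    exact hneg _ hij
  · intro i
    rw [← hcard, ← Finset.card_map (s := S) (Equiv.addLeft i).toEmbedding]
    congr 1
    ext j
    simp only [Finset.mem_filter, Finset.mem_univ, true_and, Finset.mem_map,
      Equiv.coe_toEmbedding, Equiv.coe_addLeft]
    constructor
    · exact fun hj => ⟨j - i, hj, by abel⟩
    · rintro ⟨s, hs, rfl⟩
      simpa using hs

lemma mem_regularGraphs {n d : ℕ} {G : SimpleGraph (Fin n)} :
    G ∈ regularGraphs n d ↔ IsReg G d := by
  rw [regularGraphs, Finset.mem_filter, and_iff_right (Finset.mem_univ _),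
    SimpleGraph.IsRegularOfDegree, IsReg]
  refine forall_congr' fun v => ?_
  rw [← SimpleGraph.card_neighborFinset_eq_degree, SimpleGraph.neighborFinset_eq_filter]

lemma regularGraphs_eq_regFamily (n d : ℕ) : regularGraphs n d = regFamily (Fin n) d := by
  ext G
  rw [mem_regularGraphs]
  simp [regFamily]

end Existence

/-! ### Quantitative bounds and asymptotics -/

section Limit

open Classical

/-- Sparse balls force a lower bound for the probability of any property they imply. -/
lemma one_sub_le_regularProb {n d r : ℕ} {P : SimpleGraph (Fin n) → Prop} {b : ℝ}
    (hne : (regularGraphs n d).Nonempty)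
    (hP : ∀ G, IsReg G d → SparseBalls G r → P G)
    (hb : countWhere (regFamily (Fin n) d) (fun G => ¬ SparseBalls G r)
      ≤ b * (regFamily (Fin n) d).card) :
    1 - b ≤ regularProb n d P := by
  rw [regularProb, regularGraphs_eq_regFamily] at *
  set R := regFamily (Fin n) d
  have hpos : (0 : ℝ) < R.card := by exact_mod_cast Finset.card_pos.2 hne
  rw [le_div_iff₀ hpos]
  have h1 : R ⊆ (R.filter P) ∪ (R.filter fun G => ¬ SparseBalls G r) := by
    intro G hG
    by_cases hs : SparseBalls G r
    · exact Finset.mem_union_left _ (Finset.mem_filter.2 ⟨hG,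
        hP G (Finset.mem_filter.1 hG).2 hs⟩)
    · exact Finset.mem_union_right _ (Finset.mem_filter.2 ⟨hG, hs⟩)
  have h2 := (Finset.card_le_card h1).trans (Finset.card_union_le _ _)
  have h3 : (R.card : ℝ) ≤ (R.filter P).card + (R.filter fun G => ¬ SparseBalls G r).card := by
    exact_mod_cast h2
  have h4 : countWhere R (fun G => ¬ SparseBalls G r)
      = ((R.filter fun G => ¬ SparseBalls G r).card : ℝ) := by
    simp only [countWhere]
    congr!
  linarith

lemma regularProb_le_one (n d : ℕ) (P : SimpleGraph (Fin n) → Prop) : regularProb n d P ≤ 1 := by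
  rw [regularProb]
  apply div_le_one_of_le₀ _ (Nat.cast_nonneg _)
  exact_mod_cast Finset.card_filter_le _ _

/-- Quantitative bound for the number of regular graphs without sparse balls. -/
lemma card_not_sparseBalls_le_of_le {V : Type*} [Fintype V] {n d r : ℕ} {D : ℝ}
    (hV : Fintype.card V = n) (hn : 0 < n) (hd : 1 ≤ d)
    (hc : 0 < (n * d : ℝ) - (2 * (4 * r + 7 : ℝ) + 2 * ((d + 1) * d)))
    (hD : (n * d : ℝ) * d ≤ D * ((n * d : ℝ) - (2 * (4 * r + 7 : ℝ) + 2 * ((d + 1) * d)))) :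
    countWhere (regFamily V d) (fun G => ¬ SparseBalls G r) ≤
      ((4 * r + 7 : ℝ) ^ 10 * D ^ (4 * r + 2) / n) * (regFamily V d).card := by
  set c : ℝ := (n * d : ℝ) - (2 * (4 * r + 7 : ℝ) + 2 * ((d + 1) * d)) with hcdef
  set q : ℝ := d ^ 2 / c with hq
  have hn0 : (0 : ℝ) < n := by exact_mod_cast hn
  have hd1 : (1 : ℝ) ≤ d := by exact_mod_cast hd
  have hq0 : 0 ≤ q := by positivity
  have hcn : c ≤ n * d := by
    have : (0 : ℝ) ≤ 2 * (4 * r + 7 : ℝ) + 2 * ((d + 1) * d) := by positivity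
    linarith
  have ht1 : 1 ≤ (n : ℝ) * q := by
    rw [hq, ← mul_div_assoc, le_div_iff₀ hc, one_mul]
    have : (n : ℝ) * d ≤ n * d ^ 2 := by
      apply mul_le_mul_of_nonneg_left _ hn0.le
      nlinarith
    linarith
  have htD : (n : ℝ) * q ≤ D := by
    rw [hq, ← mul_div_assoc, div_le_iff₀ hc]
    calc (n : ℝ) * d ^ 2 = n * d * d := by ring
      _ ≤ _ := hD
  have hR : ∀ F : Finset (Sym2 V), F.card ≤ 4 * r + 7 → ∀ e, e ∉ F → ¬ e.IsDiag →
      countContaining (regFamily V d) (insert e F)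
        ≤ q * countContaining (regFamily V d) F := by
    intro F hF e heF he
    have h1 := countContaining_insert_mul_le (d := d) heF he
    rw [hV] at h1
    have hF' : (F.card : ℝ) ≤ 4 * r + 7 := by exact_mod_cast hF
    have h2 : c ≤ n * d - (2 * F.card + 2 * ((d + 1) * d)) := by linarith
    have h3 : 0 ≤ countContaining (regFamily V d) (insert e F) := by
      unfold countContaining countWhere
      positivity
    rw [hq, div_mul_eq_mul_div, le_div_iff₀ hc]
    exact (mul_le_mul_of_nonneg_left h2 h3).trans h1
  have h1 := card_not_sparseBalls_le hq0 (by rwa [hV]) hR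
  rw [hV] at h1
  refine h1.trans (mul_le_mul_of_nonneg_right ?_ (Nat.cast_nonneg _))
  -- The two surplus edges produce the decisive factor: `n * q^2 = (n * q)^2 / n`.
  have h2 : (n : ℝ) * ((r + 1 : ℝ) ^ 4 * ((4 * r + 7 : ℝ) ^ 6 * q ^ 2 * (n * q) ^ (4 * r)))
      = (r + 1 : ℝ) ^ 4 * (4 * r + 7 : ℝ) ^ 6 * (n * q) ^ (4 * r + 2) / n := by
    field_simp
    ring
  rw [h2]
  have h3 : (r + 1 : ℝ) ≤ 4 * r + 7 := by
    have : (0 : ℝ) ≤ r := Nat.cast_nonneg r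
    linarith
  calc (r + 1 : ℝ) ^ 4 * (4 * r + 7 : ℝ) ^ 6 * (n * q) ^ (4 * r + 2) / n
      ≤ (4 * r + 7 : ℝ) ^ 4 * (4 * r + 7 : ℝ) ^ 6 * D ^ (4 * r + 2) / n := by gcongr
    _ = _ := by ring

/-- Powers of logarithms are negligible against powers. -/
lemma tendsto_log_pow_mul_exp (k : ℕ) {C γ : ℝ} (hγ : 0 < γ) :
    Tendsto (fun n : ℕ => C * (Real.log n ^ k * Real.exp (-γ * Real.log n))) atTop (𝓝 0) := by
  have h1 : Tendsto (fun s : ℝ => s ^ k / Real.exp (γ * s)) atTop (𝓝 0) :=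
    (isLittleO_pow_exp_pos_mul_atTop k hγ).tendsto_div_nhds_zero
  have h2 := (h1.comp (Real.tendsto_log_atTop.comp tendsto_natCast_atTop_atTop)).const_mul C
  rw [mul_zero] at h2
  refine h2.congr fun n => ?_
  simp only [Function.comp]
  rw [neg_mul, Real.exp_neg, div_eq_mul_inv]

/-- A linear function of the logarithm is eventually smaller than any linear function. -/
lemma eventually_log_le {a b κ : ℝ} (hκ : 0 < κ) :
    ∀ᶠ n : ℕ in atTop, a * Real.log n + b ≤ κ * n := by
  have h1 : (fun n : ℕ => Real.log (n : ℝ)) =o[atTop] fun n : ℕ => (n : ℝ) :=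
    Real.isLittleO_log_id_atTop.comp_tendsto tendsto_natCast_atTop_atTop
  have h2 : (fun _ : ℕ => b) =o[atTop] fun n : ℕ => (n : ℝ) :=
    (Asymptotics.isLittleO_const_id_atTop b).comp_tendsto tendsto_natCast_atTop_atTop
  have h3 := ((h1.const_mul_left a).add h2).def hκ
  filter_upwards [h3] with n hn
  rw [Real.norm_of_nonneg (Nat.cast_nonneg n)] at hn
  exact (le_abs_self _).trans hn

end Limit

end GraphPowering

/-! ### Choice of parameters and conclusion -/

theorem mainTheorem6 :
    ∃ η : ℕ → ℝ, Tendsto η atTop (𝓝 0) ∧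
      ∀ d : ℕ, 1 ≤ d → ∀ ε : ℝ, 0 < ε → ε * Real.log (d : ℝ) < 1 / 4 →
        ∀ r : ℕ → ℕ, (∀ n : ℕ, |(r n : ℝ) - ε * Real.log (n : ℝ)| < 1) →
          Tendsto
            (fun n : ℕ => GraphPowering.regularProb n d fun G =>
              (∀ x : Fin n, GraphPowering.AtMostOneCycle
                (G.induce (GraphPowering.closedBall G x (r n)))) ∧
              ((d : ℝ) - 1) ^ (r n : ℤ) - 2 * ((d : ℝ) - 1) ^ ((r n : ℤ) - 2)
                ≤ (GraphPowering.delta G (r n) : ℝ) ∧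
              |GraphPowering.dHat G (r n) - (d : ℝ)| ≤ η d * (d : ℝ))
            (atTop ⊓ 𝓟 {n : ℕ | Even (n * d)}) (𝓝 1) := by
  refine ⟨fun d => 3 / (d : ℝ), tendsto_const_div_atTop_nhds_zero_nat 3, ?_⟩
  intro d hd ε hε hεd r hr
  have hd1 : (1 : ℝ) ≤ d := by exact_mod_cast hd
  -- Half of the slack in `ε log d < 1/4` is spent on enlarging `d` to `D = d * exp θ`, which
  -- absorbs the error terms of the switching bound; the other half keeps `γ` positive.
  set θ : ℝ := (1 / 4 - ε * Real.log d) / (2 * ε) with hθ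
  have hθ0 : 0 < θ := div_pos (by linarith) (by linarith)
  set D : ℝ := d * Real.exp θ with hDdef
  have hD0 : 0 < D := by positivity
  have hlogD : Real.log D = Real.log d + θ := by
    rw [hDdef, Real.log_mul (by positivity) (Real.exp_pos _).ne', Real.log_exp]
  have hlogD0 : 0 ≤ Real.log D := by
    rw [hlogD]
    have := Real.log_nonneg hd1
    linarith
  set γ : ℝ := 1 - 4 * ε * Real.log D with hγ
  have hγ0 : 0 < γ := by
    have h1 : ε * θ = (1 / 4 - ε * Real.log d) / 2 := by
      rw [hθ]
      field_simp
    have h2 : 4 * ε * Real.log D = 4 * (ε * Real.log d) + 4 * (ε * θ) := by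
      rw [hlogD]
      ring
    rw [hγ, h2, h1]
    linarith
  set κ : ℝ := d * (1 - Real.exp (-θ)) / 2 with hκ
  have hexp : Real.exp (-θ) < 1 := by
    rw [← Real.exp_zero]
    exact Real.exp_lt_exp.2 (by linarith)
  have hκ0 : 0 < κ := by
    have : 0 < 1 - Real.exp (-θ) := by linarith
    positivity
  set C : ℝ := (4 * ε + 11) ^ 10 * D ^ 6 with hC
  have hlim := (GraphPowering.tendsto_log_pow_mul_exp 10 (C := C) hγ0).const_sub 1
  rw [sub_zero] at hlim
  refine tendsto_of_tendsto_of_tendsto_of_le_of_le' (hlim.mono_left inf_le_left)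
    tendsto_const_nhds ?_ (Eventually.of_forall fun n => GraphPowering.regularProb_le_one n d _)
  rw [eventually_inf_principal]
  have hlog : Tendsto (fun n : ℕ => Real.log (n : ℝ)) atTop atTop :=
    Real.tendsto_log_atTop.comp tendsto_natCast_atTop_atTop
  -- The bound `4/ε` on `log n` yields `r n ≥ 3`. The constant 22 is `14 + 8`, from `2 * (4r + 7)`
  -- and `r < ε log n + 1`.
  filter_upwards [eventually_gt_atTop d, hlog.eventually_ge_atTop (max 1 (4 / ε)),
    GraphPowering.eventually_log_le (a := 8 * ε) (b := 22 + 2 * ((d + 1) * d)) hκ0]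
    with n hdn hL hsmall heven
  have hn : 0 < n := by omega
  have hn0 : (0 : ℝ) < n := by exact_mod_cast hn
  have hL1 : 1 ≤ Real.log n := (le_max_left _ _).trans hL
  have hL2 : 4 ≤ ε * Real.log n := by
    have := (le_max_right _ _).trans hL
    rw [div_le_iff₀ hε] at this
    linarith
  have hrn := abs_lt.1 (hr n)
  have hr3 : 3 ≤ r n := by
    have h1 : (3 : ℝ) < r n := by linarith
    exact_mod_cast h1.le
  have hcge : (n * d : ℝ) * Real.exp (-θ)
      ≤ (n * d : ℝ) - (2 * (4 * r n + 7 : ℝ) + 2 * ((d + 1) * d)) := by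
    have h1 : 2 * (4 * r n + 7 : ℝ) + 2 * ((d + 1) * d) ≤ κ * n := by linarith
    have h2 : κ * n ≤ (n * d : ℝ) - (n * d : ℝ) * Real.exp (-θ) := by
      have h3 : (n * d : ℝ) - (n * d : ℝ) * Real.exp (-θ) = 2 * (κ * n) := by
        rw [hκ]
        ring
      have h4 : 0 ≤ κ * n := by positivity
      linarith
    linarith
  have hbound := GraphPowering.card_not_sparseBalls_le_of_le (D := D) (Fintype.card_fin n) hn hd
    (lt_of_lt_of_le (by positivity) hcge) (by
      refine le_trans (le_of_eq ?_) (mul_le_mul_of_nonneg_left hcge hD0.le)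
      rw [hDdef, Real.exp_neg]
      field_simp)
  have hle : (4 * r n + 7 : ℝ) ^ 10 * D ^ (4 * r n + 2) / n
      ≤ C * (Real.log n ^ 10 * Real.exp (-γ * Real.log n)) := by
    have h1 : (4 * r n + 7 : ℝ) ≤ (4 * ε + 11) * Real.log n := by linarith
    have h2 : D ^ (4 * r n + 2) ≤ D ^ 6 * Real.exp (4 * ε * Real.log D * Real.log n) := by
      have h3 : D ^ (4 * r n + 2) = Real.exp ((4 * r n + 2 : ℝ) * Real.log D) := by
        rw [mul_comm _ (Real.log D), Real.exp_mul, Real.exp_log hD0, ← Real.rpow_natCast]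
        push_cast
        rfl
      have h4 : D ^ 6 = Real.exp (6 * Real.log D) := by
        rw [mul_comm _ (Real.log D), Real.exp_mul, Real.exp_log hD0, ← Real.rpow_natCast]
        norm_num
      rw [h3, h4, ← Real.exp_add]
      apply Real.exp_le_exp.2
      have h5 : (4 * r n + 2 : ℝ) * Real.log D ≤ (4 * (ε * Real.log n) + 6) * Real.log D :=
        mul_le_mul_of_nonneg_right (by linarith) hlogD0
      linarith
    have h3 : (n : ℝ) = Real.exp (Real.log n) := (Real.exp_log hn0).symm
    calc (4 * r n + 7 : ℝ) ^ 10 * D ^ (4 * r n + 2) / n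
        ≤ ((4 * ε + 11) * Real.log n) ^ 10
          * (D ^ 6 * Real.exp (4 * ε * Real.log D * Real.log n)) / n := by gcongr
      _ = C * (Real.log n ^ 10 * (Real.exp (4 * ε * Real.log D * Real.log n) / n)) := by
          rw [hC]
          ring
      _ = C * (Real.log n ^ 10 * Real.exp (-γ * Real.log n)) := by
          have h4 : Real.exp (4 * ε * Real.log D * Real.log n) / n
              = Real.exp (-γ * Real.log n) := by
            rw [div_eq_iff hn0.ne']
            conv_rhs => rw [h3]
            rw [Real.log_exp, ← Real.exp_add, hγ]
            ring_nf
          rw [h4]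
  -- Without a regular graph the probability would be `0 / 0 = 0`.
  obtain ⟨G₀, hG₀⟩ := GraphPowering.exists_isReg hdn heven
  have : Nonempty (Fin n) := ⟨⟨0, hn⟩⟩
  exact GraphPowering.one_sub_le_regularProb (r := r n)
    ⟨G₀, GraphPowering.mem_regularGraphs.2 hG₀⟩
    (fun G hG hs => hs.conclusion hG hd hr3)
    (hbound.trans (mul_le_mul_of_nonneg_right hle (Nat.cast_nonneg _)))
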